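/- A first-order language is called relational if it has only relation symbols (of various arities) and constant symbols, with no function symbols and no equality; let $\mathcal L$ be a countable relational language. Formulas of $\mathbf G^\Delta$ over $\mathcal L$ are built from atomic formulas $R(t_1,\dots,t_n)$, where each $t_i$ is a variable or a constant symbol, and $\bot$, by $\wedge,\vee,\to$, the unary connective $\Delta$, and $\forall x,\exists x$; a formula is closed if it has no free variables. A valuation $v$ consists of a nonempty set $M$, a function $R^v:M^k\to[0,1]$ for each $k$-ary relation symbol $R$, and an element $c^v\in M$ for each constant symbol $c$. Values of formulas in $[0,1]$ are given by $v(R(\bar a))=R^v(\bar a)$ (constants being interpreted by $c^v$), $v(\bot)=0$, $v(\varphi\wedge\psi)=\min\{v(\varphi),v(\psi)\}$, $v(\varphi\vee\psi)=\max\{v(\varphi),v(\psi)\}$; $v(\varphi\to\psi)=1$ if $v(\varphi)\le v(\psi)$ and $v(\varphi\to\psi)=v(\psi)$ otherwise; $v(\Delta\varphi)=1$ if $v(\varphi)=1$ and $v(\Delta\varphi)=0$ otherwise; $v(\forall x\,\varphi(x,\bar b))=\inf_{a\in M}v(\varphi(a,\bar b))$ and $v(\exists x\,\varphi(x,\bar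 b))=\sup_{a\in M}v(\varphi(a,\bar b))$. For closed formulas write $\varphi\Vdash\psi$ if every valuation $v$ with $v(\varphi)=1$ satisfies $v(\psi)=1$, and let $\mathcal L_\varphi$ be the set of relation and constant symbols that occur in $\varphi$. **Theorem (Craig interpolation in $\mathbf G^\Delta$).** Let $\varphi$ and $\psi$ be closed $\mathbf G^\Delta$-formulas over $\mathcal L$ with $\varphi\Vdash\psi$. Then there is a closed $\mathbf G^\Delta$-formula $\theta$, all of whose relation and constant symbols lie in $\mathcal L_\varphi\cap\mathcal L_\psi$, such that $\varphi\Vdash\theta$ and $\theta\Vdash\psi$. -/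

import Mathlib

universe u v w

namespace GodelDelta

/-- A relational first-order language: relation symbols of every arity, and constant symbols
(no function symbols of positive arity, no equality symbol). -/
structure RelLanguage where
  /-- the relation symbols of arity `k` -/
  Rel : ℕ → Type u
  /-- the constant symbols -/
  Const : Type v

/-- The symbols of `L`: a relation symbol (with its arity) or a constant symbol. -/
abbrev RelLanguage.Symbol (L : RelLanguage.{u, v}) : Type (max u v) :=
  (Σ k : ℕ, L.Rel k) ⊕ L.Const

/-- Terms with free variables among `x_0, …, x_{n-1}`: variables and constant symbols. -/
inductive Term (L : RelLanguage.{u, v}) (n : ℕ) : Type v where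
  | var : Fin n → Term L n
  | const : L.Const → Term L n

/-- Formulas of Gödel logic with `Δ` whose free variables are among `x_0, …, x_{n-1}`.
The quantifiers bind the last variable `x_n` of a formula in `x_0, …, x_n`
(so formulas are taken up to renaming of bound variables). -/
inductive Formula (L : RelLanguage.{u, v}) : ℕ → Type (max u v) where
  | rel {n k : ℕ} (R : L.Rel k) (ts : Fin k → Term L n) : Formula L n
  | and {n : ℕ} (φ ψ : Formula L n) : Formula L n
  | or {n : ℕ} (φ ψ : Formula L n) : Formula L n
  | imp {n : ℕ} (φ ψ : Formula L n) : Formula L n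
  | delta {n : ℕ} (φ : Formula L n) : Formula L n
  | bot {n : ℕ} : Formula L n
  | all {n : ℕ} (φ : Formula L (n + 1)) : Formula L n
  | ex {n : ℕ} (φ : Formula L (n + 1)) : Formula L n

/-- A closed formula is a formula without free variables. -/
abbrev ClosedFormula (L : RelLanguage.{u, v}) : Type (max u v) := Formula L 0

/-- The symbols occurring in a term. -/
def Term.symbols {L : RelLanguage.{u, v}} {n : ℕ} : Term L n → Set L.Symbol
  | .var _ => ∅
  | .const c => {Sum.inr c}

/-- The language of a formula: the relation and constant symbols that occur in it. -/
def Formula.symbols {L : RelLanguage.{u, v}} : {n : ℕ} → Formula L n → Set L.Symbol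
  | _, .rel R ts => {Sum.inl ⟨_, R⟩} ∪ ⋃ i, (ts i).symbols
  | _, .and φ ψ => φ.symbols ∪ ψ.symbols
  | _, .or φ ψ => φ.symbols ∪ ψ.symbols
  | _, .imp φ ψ => φ.symbols ∪ ψ.symbols
  | _, .delta φ => φ.symbols
  | _, .bot => ∅
  | _, .all φ => φ.symbols
  | _, .ex φ => φ.symbols

/-- A (standard) valuation: a nonempty universe, a `[0,1]`-valued function for each relation
symbol, and an element for each constant symbol. -/
structure Valuation (L : RelLanguage.{u, v}) where
  /-- the universe -/
  M : Type w
  nonempty : Nonempty M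
  /-- the interpretation of the relation symbols -/
  rel : {k : ℕ} → L.Rel k → (Fin k → M) → unitInterval
  /-- the interpretation of the constant symbols -/
  const : L.Const → M

/-- The interpretation of a term at a tuple `a`. -/
def Valuation.termValue {L : RelLanguage.{u, v}} (V : Valuation.{u, v, w} L) {n : ℕ}
    (a : Fin n → V.M) : Term L n → V.M
  | .var i => a i
  | .const c => V.const c

open Classical in
/-- The value in `[0,1]` of a formula at a tuple `a`. -/
noncomputable def Valuation.value {L : RelLanguage.{u, v}} (V : Valuation.{u, v, w} L) :
    {n : ℕ} → Formula L n → (Fin n → V.M) → unitInterval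
  | _, .rel R ts, a => V.rel R (fun i => V.termValue a (ts i))
  | _, .and φ ψ, a => min (V.value φ a) (V.value ψ a)
  | _, .or φ ψ, a => max (V.value φ a) (V.value ψ a)
  | _, .imp φ ψ, a => if V.value φ a ≤ V.value ψ a then 1 else V.value ψ a
  | _, .delta φ, a => if V.value φ a = 1 then 1 else 0
  | _, .bot, _ => 0
  | _, .all φ, a => ⨅ m : V.M, V.value φ (Fin.snoc a m)
  | _, .ex φ, a => ⨆ m : V.M, V.value φ (Fin.snoc a m)

/-- `V` is a model of the closed formula `φ`: its value is `1`. -/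
def Valuation.Models {L : RelLanguage.{u, v}} (V : Valuation.{u, v, w} L)
    (φ : ClosedFormula L) : Prop :=
  V.value φ Fin.elim0 = 1

/-- `T` 1-entails `φ`: every valuation that models every member of the theory `T` models `φ`. -/
def Entails {L : RelLanguage.{u, v}} (T : Set (ClosedFormula L)) (φ : ClosedFormula L) : Prop :=
  ∀ V : Valuation.{u, v, w} L, (∀ χ ∈ T, V.Models χ) → V.Models φ

end GodelDelta

/-!
Suppose that there is no interpolant. By compactness there are two ultraproducts of valuations, one
of models of `φ` and one of valuations in which `ψ` fails, that agree on all closed formulas of the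
common language. It remains to amalgamate them as in Robinson's joint consistency theorem
(`exists_common_valuation`), and the difficulty lies in the truth values: a supremum or infimum
that a quantifier takes in one ultraproduct must not be spoiled by truth values of the other one.

Ultraproducts over `ℕ` are countably saturated (`exists_internal`), and so is their order of truth
values, the germs of sequences in `[0,1]` (`Hyper.exists_between`). Hence no new constants are
needed: the elements of the common model are pairs of an element of the first and an element of the
second ultraproduct, and a countable set `P` of such pairs is built by a back-and-forth argument, as
an increasing union of partial isomorphisms for the common language. Along with `P` one builds a set
`Q` of pairs of truth values that are to be identified.

The crucial step is `Approx.separate`. Let `a` and `b` be truth values of the two ultraproducts that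
fill the same cut `D` in the truth values definable over `P` in the common language. Either every
formula of the common language takes no value in some definable interval around `D`; then no
extension of `P` will ever put a definable value into `D`, and `a` and `b` may be identified. Or a
formula `r` takes values arbitrarily close to `D`. Then `P` can be extended by a tuple at which the
value of `r` is less than `a` in the first ultraproduct and greater than `b` in the second: choose
a tuple `z₀` with `r z₀` in `D`; if a formula `p` of its type excluded `r z < a`, then the infimum of
`r` on `p` would be definable, hence not in `D`, hence above `D`, which contradicts `r z₀ ∈ D`; the
supremum of `r` on `p` serves for `b`. So all truth values of the two sides get either identified or
separated by definable ones (`Decided`), and quantifiers keep their values in the union of the two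
orders (`exists_amalgam`). This union is a countable linear order, and it embeds into `[0,1]` with
all suprema and infima that exist (`exists_continuous_embedding`).
-/

namespace GodelDelta

/-! ### Substitution and tuples of quantifiers -/

/-- Simultaneous substitution of terms for the variables of a term. -/
def Term.subst {L : RelLanguage.{u, v}} {n m : ℕ} (σ : Fin n → Term L m) : Term L n → Term L m
  | .var i => σ i
  | .const c => .const c

/-- A term in `x_0, …, x_{n-1}` seen as a term in `x_0, …, x_n`. -/
def Term.weaken {L : RelLanguage.{u, v}} {n : ℕ} : Term L n → Term L (n + 1)
  | .var i => .var i.castSucc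
  | .const c => .const c

/-- Simultaneous substitution of terms for the free variables of a formula. Variables are numbered
by levels, so below a quantifier the substitution is extended by sending the new last variable to
the new last variable. -/
def Formula.subst {L : RelLanguage.{u, v}} :
    {n m : ℕ} → Formula L n → (Fin n → Term L m) → Formula L m
  | _, _, .rel R ts, σ => .rel R fun i => (ts i).subst σ
  | _, _, .and φ ψ, σ => .and (φ.subst σ) (ψ.subst σ)
  | _, _, .or φ ψ, σ => .or (φ.subst σ) (ψ.subst σ)
  | _, _, .imp φ ψ, σ => .imp (φ.subst σ) (ψ.subst σ)
  | _, _, .delta φ, σ => .delta (φ.subst σ)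
  | _, _, .bot, _ => .bot
  | _, m, .all φ, σ => .all (φ.subst (Fin.snoc (fun i => (σ i).weaken) (.var (Fin.last m))))
  | _, m, .ex φ, σ => .ex (φ.subst (Fin.snoc (fun i => (σ i).weaken) (.var (Fin.last m))))

section Subst

variable {L : RelLanguage.{u, v}}

theorem Valuation.termValue_subst (V : Valuation.{u, v, w} L) {n m : ℕ} (t : Term L n)
    (σ : Fin n → Term L m) (a : Fin m → V.M) :
    V.termValue a (t.subst σ) = V.termValue (fun i => V.termValue a (σ i)) t := by
  cases t <;> rfl

theorem Valuation.termValue_weaken (V : Valuation.{u, v, w} L) {n : ℕ} (t : Term L n)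
    (a : Fin n → V.M) (x : V.M) : V.termValue (Fin.snoc a x) t.weaken = V.termValue a t := by
  cases t <;> simp [Term.weaken, Valuation.termValue]

theorem Valuation.termValue_snoc_weaken (V : Valuation.{u, v, w} L) {n m : ℕ}
    (σ : Fin n → Term L m) (a : Fin m → V.M) (x : V.M) :
    (fun i => V.termValue (Fin.snoc a x) ((Fin.snoc (fun i => (σ i).weaken)
      (.var (Fin.last m)) : Fin (n + 1) → Term L (m + 1)) i)) =
      (Fin.snoc (fun i => V.termValue a (σ i)) x : Fin (n + 1) → V.M) := by
  funext i
  refine Fin.lastCases ?_ (fun j => ?_) i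
  · simp [Valuation.termValue]
  · simp [Valuation.termValue_weaken]

theorem Valuation.value_subst (V : Valuation.{u, v, w} L) {n : ℕ} (φ : Formula L n) :
    ∀ {m : ℕ} (σ : Fin n → Term L m) (a : Fin m → V.M),
      V.value (φ.subst σ) a = V.value φ (fun i => V.termValue a (σ i)) := by
  induction φ with
  | rel R ts =>
    intro m σ a
    simp only [Formula.subst, Valuation.value, Valuation.termValue_subst]
  | and φ ψ ih₁ ih₂ | or φ ψ ih₁ ih₂ | imp φ ψ ih₁ ih₂ =>
    intro m σ a
    simp only [Formula.subst, Valuation.value, ih₁, ih₂]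
  | delta φ ih =>
    intro m σ a
    simp only [Formula.subst, Valuation.value, ih]
  | bot => intro m σ a; rfl
  | all φ ih | ex φ ih =>
    intro m σ a
    simp only [Formula.subst, Valuation.value, ih, Valuation.termValue_snoc_weaken]

theorem Term.symbols_subst {n m : ℕ} (t : Term L n) (σ : Fin n → Term L m) :
    (t.subst σ).symbols ⊆ t.symbols ∪ ⋃ i, (σ i).symbols := by
  cases t with
  | var i => exact (Set.subset_iUnion (fun i => (σ i).symbols) i).trans Set.subset_union_right
  | const c => exact Set.subset_union_left

theorem Term.symbols_weaken {n : ℕ} (t : Term L n) : t.weaken.symbols = t.symbols := by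
  cases t <;> rfl

theorem Formula.symbols_subst {S : Set L.Symbol} {n : ℕ} (φ : Formula L n) :
    ∀ {m : ℕ} (σ : Fin n → Term L m), φ.symbols ⊆ S → (∀ i, (σ i).symbols ⊆ S) →
      (φ.subst σ).symbols ⊆ S := by
  have lift : ∀ {n m : ℕ} (σ : Fin n → Term L m), (∀ i, (σ i).symbols ⊆ S) → ∀ i,
      ((Fin.snoc (fun i => (σ i).weaken) (.var (Fin.last m)) :
        Fin (n + 1) → Term L (m + 1)) i).symbols ⊆ S := by
    intro n m σ hσ i
    refine Fin.lastCases ?_ (fun j => ?_) i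
    · simp [Term.symbols]
    · simpa [Term.symbols_weaken] using hσ j
  induction φ with
  | rel R ts =>
    intro m σ hφ hσ
    simp only [Formula.subst, Formula.symbols, Set.union_subset_iff, Set.iUnion_subset_iff] at hφ ⊢
    exact ⟨hφ.1, fun i => (Term.symbols_subst _ _).trans
      (Set.union_subset (hφ.2 i) (Set.iUnion_subset hσ))⟩
  | and φ ψ ih₁ ih₂ | or φ ψ ih₁ ih₂ | imp φ ψ ih₁ ih₂ =>
    intro m σ hφ hσ
    simp only [Formula.subst, Formula.symbols, Set.union_subset_iff] at hφ ⊢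
    exact ⟨ih₁ σ hφ.1 hσ, ih₂ σ hφ.2 hσ⟩
  | delta φ ih => intro m σ hφ hσ; exact ih σ hφ hσ
  | bot => intro m σ hφ hσ; simp [Formula.subst, Formula.symbols]
  | all φ ih | ex φ ih => intro m σ hφ hσ; exact ih _ hφ (lift σ hσ)

/-- Existential quantification over the last `k` variables. -/
def Formula.exs {n : ℕ} : (k : ℕ) → Formula L (n + k) → Formula L n
  | 0, φ => φ
  | k + 1, φ => Formula.exs k (.ex φ)

/-- Universal quantification over the last `k` variables. -/
def Formula.alls {n : ℕ} : (k : ℕ) → Formula L (n + k) → Formula L n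
  | 0, φ => φ
  | k + 1, φ => Formula.alls k (.all φ)

theorem Formula.symbols_exs {n : ℕ} : ∀ (k : ℕ) (φ : Formula L (n + k)),
    (φ.exs k).symbols = φ.symbols
  | 0, _ => rfl
  | k + 1, φ => Formula.symbols_exs k (.ex φ)

theorem Formula.symbols_alls {n : ℕ} : ∀ (k : ℕ) (φ : Formula L (n + k)),
    (φ.alls k).symbols = φ.symbols
  | 0, _ => rfl
  | k + 1, φ => Formula.symbols_alls k (.all φ)

theorem Valuation.value_exs (V : Valuation.{u, v, w} L) {n : ℕ} (a : Fin n → V.M) :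
    ∀ (k : ℕ) (φ : Formula L (n + k)),
      V.value (φ.exs k) a = ⨆ z : Fin k → V.M, V.value φ (Fin.append a z)
  | 0, φ => by
    simp only [Formula.exs, iSup_unique]
    congr 1
    exact (Fin.append_elim0 a).symm
  | k + 1, φ => by
    simp only [Formula.exs, Valuation.value_exs V a k, Valuation.value]
    apply le_antisymm
    · exact iSup_le fun z => iSup_le fun x => by
        rw [← Fin.append_snoc]
        exact le_iSup (fun z => V.value φ (Fin.append a z)) _
    · refine iSup_le fun z => ?_
      rw [← Fin.snoc_init_self z, Fin.append_snoc]
      exact le_trans (le_iSup (fun x => V.value φ (Fin.snoc (Fin.append a (Fin.init z)) x)) _)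
        (le_iSup (fun z => ⨆ x, V.value φ (Fin.snoc (Fin.append a z) x)) _)

theorem Valuation.value_alls (V : Valuation.{u, v, w} L) {n : ℕ} (a : Fin n → V.M) :
    ∀ (k : ℕ) (φ : Formula L (n + k)),
      V.value (φ.alls k) a = ⨅ z : Fin k → V.M, V.value φ (Fin.append a z)
  | 0, φ => by
    simp only [Formula.alls, iInf_unique]
    congr 1
    exact (Fin.append_elim0 a).symm
  | k + 1, φ => by
    simp only [Formula.alls, Valuation.value_alls V a k, Valuation.value]
    apply le_antisymm
    · refine le_iInf fun z => ?_
      rw [← Fin.snoc_init_self z, Fin.append_snoc]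
      exact le_trans (iInf_le (fun z => ⨅ x, V.value φ (Fin.snoc (Fin.append a z) x)) _)
        (iInf_le (fun x => V.value φ (Fin.snoc (Fin.append a (Fin.init z)) x)) _)
    · exact le_iInf fun z => le_iInf fun x => by
        rw [← Fin.append_snoc]
        exact iInf_le (fun z => V.value φ (Fin.append a z)) _

end Subst

/-! ### Countability of the set of formulas -/

section Countable

variable {L : RelLanguage.{u, v}}

instance Term.countable [Countable L.Const] (n : ℕ) : Countable (Term L n) := by
  let f : Fin n ⊕ L.Const → Term L n := Sum.elim .var .const
  refine Function.Surjective.countable (f := f) ?_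
  rintro (i | c)
  exacts [⟨.inl i, rfl⟩, ⟨.inr c, rfl⟩]

/-- The formulas of nesting depth less than `d`. -/
def Formula.ofDepth : ℕ → (n : ℕ) → Set (Formula L n)
  | 0, _ => ∅
  | d + 1, n =>
    Set.range (fun x : Σ k, L.Rel k × (Fin k → Term L n) => .rel x.2.1 x.2.2) ∪
    Set.image2 .and (ofDepth d n) (ofDepth d n) ∪ Set.image2 .or (ofDepth d n) (ofDepth d n) ∪
    Set.image2 .imp (ofDepth d n) (ofDepth d n) ∪ .delta '' ofDepth d n ∪ {.bot} ∪
    .all '' ofDepth d (n + 1) ∪ .ex '' ofDepth d (n + 1)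

theorem Formula.countable_ofDepth [∀ k, Countable (L.Rel k)] [Countable L.Const] (d : ℕ) :
    ∀ n, (ofDepth d n : Set (Formula L n)).Countable := by
  induction d with
  | zero => intro n; exact Set.countable_empty
  | succ d ih =>
    intro n
    simp only [ofDepth, Set.countable_union, Set.countable_singleton]
    refine ⟨⟨⟨⟨⟨⟨⟨?_, ?_⟩, ?_⟩, ?_⟩, ?_⟩, trivial⟩, ?_⟩, ?_⟩
    · exact Set.countable_range _
    iterate 3 exact (ih n).image2 (ih n) _
    · exact (ih n).image _
    iterate 2 exact (ih (n + 1)).image _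

theorem Formula.ofDepth_mono (d : ℕ) :
    ∀ n, (ofDepth d n : Set (Formula L n)) ⊆ ofDepth (d + 1) n := by
  induction d with
  | zero => intro n; exact Set.empty_subset _
  | succ d ih =>
    intro n
    rw [ofDepth, ofDepth]
    gcongr <;> exact ih _

theorem Formula.exists_mem_ofDepth {n : ℕ} (φ : Formula L n) : ∃ d, φ ∈ ofDepth d n := by
  have mono : ∀ n, Monotone fun d => (ofDepth d n : Set (Formula L n)) :=
    fun n => monotone_nat_of_le_succ fun d => ofDepth_mono d n
  induction φ with
  | rel R ts => exact ⟨1, by simp [ofDepth]⟩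
  | bot => exact ⟨1, by simp [ofDepth]⟩
  | and φ ψ ih₁ ih₂ | or φ ψ ih₁ ih₂ | imp φ ψ ih₁ ih₂ =>
    obtain ⟨d, hd⟩ := ih₁
    obtain ⟨e, he⟩ := ih₂
    have h₁ := mono _ (le_max_left d e) hd
    have h₂ := mono _ (le_max_right d e) he
    exact ⟨max d e + 1, by simp_all [ofDepth]⟩
  | delta φ ih | all φ ih | ex φ ih =>
    obtain ⟨d, hd⟩ := ih
    exact ⟨d + 1, by simp_all [ofDepth]⟩

instance Formula.countable [∀ k, Countable (L.Rel k)] [Countable L.Const] (n : ℕ) :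
    Countable (Formula L n) := by
  rw [← Set.countable_univ_iff]
  refine (Set.countable_iUnion fun d => countable_ofDepth d n).mono fun φ _ => ?_
  exact Set.mem_iUnion.2 φ.exists_mem_ofDepth

end Countable

/-! ### Countable saturation of ultraproducts -/

section Saturation

open Filter

theorem exists_internal_of_forall_le {Z : ℕ → Type*} [∀ i, Nonempty (Z i)]
    (p : ℕ → ∀ i, Z i → Prop)
    (h : ∀ K, ∀ᶠ i in (hyperfilter ℕ : Filter ℕ), ∃ z, ∀ k ≤ K, p k i z) :
    ∃ z : ∀ i, Z i, ∀ k, ∀ᶠ i in (hyperfilter ℕ : Filter ℕ), p k i (z i) := by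
  classical
  -- At the index `i`, as many of the first `i` conditions as possible are satisfied together.
  let K : ℕ → ℕ := fun i => Nat.findGreatest (fun K => ∃ z, ∀ k ≤ K, p k i z) i
  have hz : ∀ i, ∃ z : Z i, (∃ z, ∀ k ≤ K i, p k i z) → ∀ k ≤ K i, p k i z := by
    intro i
    by_cases hi : ∃ z, ∀ k ≤ K i, p k i z
    · exact ⟨hi.choose, fun _ => hi.choose_spec⟩
    · exact ⟨Classical.arbitrary _, fun h => absurd h hi⟩
  choose z hz using hz
  refine ⟨z, fun k => ?_⟩
  filter_upwards [h k, Nat.hyperfilter_le_atTop (eventually_ge_atTop k)] with i hi hki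
  have h₁ : k ≤ K i := Nat.le_findGreatest hki hi
  have h₂ : ∃ z, ∀ k ≤ K i, p k i z :=
    Nat.findGreatest_spec (P := fun K => ∃ z, ∀ k ≤ K, p k i z) hki hi
  exact hz i h₂ k h₁

/-- Ultraproducts over `ℕ` are countably saturated: a countable directed family of internal
conditions, each of which can be satisfied, is satisfied by one internal element. -/
theorem exists_internal {ι : Type*} [Countable ι] {Z : ℕ → Type*} [∀ i, Nonempty (Z i)]
    (p : ι → ∀ i, Z i → Prop)
    (dir : ∀ a b, ∃ c, ∀ᶠ i in (hyperfilter ℕ : Filter ℕ), ∀ z, p c i z → p a i z ∧ p b i z)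
    (h : ∀ a, ∀ᶠ i in (hyperfilter ℕ : Filter ℕ), ∃ z, p a i z) :
    ∃ z : ∀ i, Z i, ∀ a, ∀ᶠ i in (hyperfilter ℕ : Filter ℕ), p a i (z i) := by
  rcases isEmpty_or_nonempty ι with hι | hι
  · exact ⟨fun i => Classical.arbitrary _, fun a => hι.elim a⟩
  obtain ⟨f, hf⟩ := exists_surjective_nat ι
  have key : ∀ K, ∃ c, ∀ᶠ i in (hyperfilter ℕ : Filter ℕ), ∀ z, p c i z →
      ∀ k ≤ K, p (f k) i z := by
    intro K
    induction K with
    | zero => exact ⟨f 0, .of_forall fun i z hz k hk => by rwa [Nat.le_zero.1 hk]⟩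
    | succ K ih =>
      obtain ⟨c, hc⟩ := ih
      obtain ⟨d, hd⟩ := dir c (f (K + 1))
      refine ⟨d, ?_⟩
      filter_upwards [hc, hd] with i hc hd z hz k hk
      rcases Nat.le_succ_iff.1 hk with hk | rfl
      · exact hc z (hd z hz).1 k hk
      · exact (hd z hz).2
  obtain ⟨z, hz⟩ := exists_internal_of_forall_le (fun k => p (f k)) fun K => by
    obtain ⟨c, hc⟩ := key K
    exact (h c).mp (hc.mono fun i hc ⟨z, hz⟩ => ⟨z, hc z hz⟩)
  exact ⟨z, fun a => by obtain ⟨k, rfl⟩ := hf a; exact hz k⟩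

end Saturation

/-! ### Definable internal functions -/

/-- The nonstandard truth values: germs of sequences in `[0,1]` along a nonprincipal ultrafilter. -/
abbrev Hyper : Type := (Filter.hyperfilter ℕ : Filter ℕ).Germ unitInterval

section Definable

variable {L : RelLanguage.{u, v}} (V : Bool → ℕ → Valuation.{u, v, w} L)

instance (V : Valuation.{u, v, w} L) : Nonempty V.M := V.nonempty

/-- A pair consisting of an element of the ultraproduct of the `V true i` and an element of the
ultraproduct of the `V false i`, given by representatives. -/
abbrev Point : Type w := ∀ s i, (V s i).M

/-- A pair of internal `[0,1]`-valued functions of `k` arguments, one on each ultraproduct. -/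
abbrev IntFun (k : ℕ) : Type w := ∀ s i, (Fin k → (V s i).M) → unitInterval

/-- The pairs of functions defined on the two ultraproducts by a formula with symbols in `S` and
parameters in the set of points `P`. -/
def Definable (S : Set L.Symbol) (P : Set (Point V)) {k : ℕ} (F : IntFun V k) : Prop :=
  ∃ (n : ℕ) (χ : Formula L (n + k)) (t : Fin n → Point V), χ.symbols ⊆ S ∧ (∀ j, t j ∈ P) ∧
    F = fun s i z => (V s i).value χ (Fin.append (fun j => t j s i) z)

/-- The pair of nonstandard truth values of a pair of internal functions without arguments. -/
noncomputable def IntFun.germ {V : Bool → ℕ → Valuation.{u, v, w} L} (F : IntFun V 0) : Bool → Hyper :=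
  fun s => ((fun i => F s i Fin.elim0 : ℕ → unitInterval) : Hyper)

/-- The nonstandard truth value of a formula at a tuple of points, in the ultraproduct `s`. -/
noncomputable def val (s : Bool) {n : ℕ} (χ : Formula L n) (t : Fin n → Point V) : Hyper :=
  ((fun i => (V s i).value χ (fun j => t j s i) : ℕ → unitInterval) : Hyper)

open Classical in
/-- The characteristic function of a pair of internal predicates. -/
noncomputable def crisp {V : Bool → ℕ → Valuation.{u, v, w} L} {k : ℕ}
    (p : ∀ s i, (Fin k → (V s i).M) → Prop) : IntFun V k :=
  fun s i z => if p s i z then 1 else 0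

variable {V} {S : Set L.Symbol} {P : Set (Point V)} {k : ℕ}

theorem Definable.mono {P' : Set (Point V)} {F : IntFun V k} (hF : Definable V S P F)
    (h : P ⊆ P') : Definable V S P' F :=
  let ⟨n, χ, t, h₁, h₂, h₃⟩ := hF
  ⟨n, χ, t, h₁, fun j => h (h₂ j), h₃⟩

theorem Definable.countable [∀ k, Countable (L.Rel k)] [Countable L.Const] (hP : P.Countable) :
    {F : IntFun V k | Definable V S P F}.Countable := by
  have := hP.to_subtype
  refine (Set.countable_range fun x : Σ n, Formula L (n + k) × (Fin n → P) =>
    (fun s i z => (V s i).value x.2.1 (Fin.append (fun j => (x.2.2 j).1 s i) z) :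
      IntFun V k)).mono ?_
  rintro F ⟨n, χ, t, -, h₂, rfl⟩
  exact ⟨⟨n, χ, fun j => ⟨t j, h₂ j⟩⟩, rfl⟩

/-- Two definable functions can be defined with the same tuple of parameters. -/
theorem Definable.common {F G : IntFun V k} (hF : Definable V S P F)
    (hG : Definable V S P G) :
    ∃ (n : ℕ) (χ ξ : Formula L (n + k)) (t : Fin n → Point V), χ.symbols ⊆ S ∧ ξ.symbols ⊆ S ∧
      (∀ j, t j ∈ P) ∧ (F = fun s i z => (V s i).value χ (Fin.append (fun j => t j s i) z)) ∧
      G = fun s i z => (V s i).value ξ (Fin.append (fun j => t j s i) z) := by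
  obtain ⟨n, χ, t, hχ, ht, rfl⟩ := hF
  obtain ⟨m, ξ, t', hξ, ht', rfl⟩ := hG
  let σ : Fin (n + k) → Term L (n + m + k) := fun i => .var
    (Fin.addCases (fun j => Fin.castAdd k (Fin.castAdd m j)) (fun j => Fin.natAdd (n + m) j) i)
  let τ : Fin (m + k) → Term L (n + m + k) := fun i => .var
    (Fin.addCases (fun j => Fin.castAdd k (Fin.natAdd n j)) (fun j => Fin.natAdd (n + m) j) i)
  refine ⟨n + m, χ.subst σ, ξ.subst τ, Fin.append t t', ?_, ?_, ?_, ?_, ?_⟩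
  · exact Formula.symbols_subst _ _ hχ fun i => by simp [σ, Term.symbols]
  · exact Formula.symbols_subst _ _ hξ fun i => by simp [τ, Term.symbols]
  · intro j
    refine Fin.addCases (fun j => ?_) (fun j => ?_) j
    · simpa using ht j
    · simpa using ht' j
  · funext s i z
    rw [Valuation.value_subst]
    congr 1
    funext j
    refine Fin.addCases (fun j => ?_) (fun j => ?_) j <;> simp [σ, Valuation.termValue]
  · funext s i z
    rw [Valuation.value_subst]
    congr 1
    funext j
    refine Fin.addCases (fun j => ?_) (fun j => ?_) j <;> simp [τ, Valuation.termValue]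

theorem Definable.min {F G : IntFun V k} (hF : Definable V S P F)
    (hG : Definable V S P G) :
    Definable V S P fun s i z => min (F s i z) (G s i z) := by
  obtain ⟨n, χ, ξ, t, h₁, h₂, ht, rfl, rfl⟩ := hF.common hG
  exact ⟨n, .and χ ξ, t, Set.union_subset h₁ h₂, ht, rfl⟩

open Classical in
theorem Definable.imp {F G : IntFun V k} (hF : Definable V S P F)
    (hG : Definable V S P G) :
    Definable V S P (fun s i z => if F s i z ≤ G s i z then 1 else G s i z) := by
  obtain ⟨n, χ, ξ, t, h₁, h₂, ht, rfl, rfl⟩ := hF.common hG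
  refine ⟨n, .imp χ ξ, t, Set.union_subset h₁ h₂, ht, ?_⟩
  simp only [Valuation.value]

theorem Definable.bot : Definable V S P (fun _ _ _ => 0 : IntFun V k) :=
  ⟨0, .bot, Fin.elim0, Set.empty_subset _, fun j => j.elim0, rfl⟩

theorem Definable.top : Definable V S P (fun _ _ _ => 1 : IntFun V k) := by
  simpa using (Definable.bot (V := V) (S := S) (P := P) (k := k)).imp .bot

/-- Pairs of internal predicates defined by a formula. -/
def DefPred (V : Bool → ℕ → Valuation.{u, v, w} L) (S : Set L.Symbol) (P : Set (Point V)) {k : ℕ}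
    (p : ∀ s i, (Fin k → (V s i).M) → Prop) : Prop :=
  Definable V S P (crisp p)

theorem Definable.eq_one {F : IntFun V k} (hF : Definable V S P F) :
    DefPred V S P (fun s i z => F s i z = 1) := by
  obtain ⟨n, χ, t, h₁, ht, rfl⟩ := hF
  refine ⟨n, .delta χ, t, h₁, ht, ?_⟩
  funext s i z
  simp only [crisp, Valuation.value]
  congr

theorem crisp_injective : Function.Injective
    (crisp : (∀ s i, (Fin k → (V s i).M) → Prop) → IntFun V k) := by
  intro p q h
  funext s i z
  have := congrFun (congrFun (congrFun h s) i) z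
  by_cases hp : p s i z <;> by_cases hq : q s i z <;> simp_all [crisp]

theorem DefPred.countable [∀ k, Countable (L.Rel k)] [Countable L.Const] (hP : P.Countable) :
    {p | DefPred V S P (k := k) p}.Countable :=
  (Definable.countable hP).preimage crisp_injective

theorem DefPred.and {p q : ∀ s i, (Fin k → (V s i).M) → Prop} (hp : DefPred V S P p)
    (hq : DefPred V S P q) : DefPred V S P (fun s i z => p s i z ∧ q s i z) := by
  have := Definable.min hp hq
  unfold DefPred
  convert this using 1
  funext s i z
  by_cases hp : p s i z <;> by_cases hq : q s i z <;> simp_all [crisp]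

theorem DefPred.not {p : ∀ s i, (Fin k → (V s i).M) → Prop} (hp : DefPred V S P p) :
    DefPred V S P (fun s i z => ¬ p s i z) := by
  have := Definable.imp hp .bot
  unfold DefPred
  convert this using 1
  funext s i z
  by_cases hp : p s i z <;> simp_all [crisp]

theorem Definable.le {F G : IntFun V k} (hF : Definable V S P F) (hG : Definable V S P G) :
    DefPred V S P fun s i z => F s i z ≤ G s i z := by
  convert (hF.imp hG).eq_one using 1
  funext s i z
  by_cases h : F s i z ≤ G s i z
  · simp [h]
  · simp only [h, if_false, eq_iff_iff, false_iff]
    exact (lt_of_lt_of_le (not_le.1 h) unitInterval.le_one').ne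

theorem Definable.lt {F G : IntFun V k} (hF : Definable V S P F) (hG : Definable V S P G) :
    DefPred V S P (fun s i z => F s i z < G s i z) := by
  simpa using (hG.le hF).not

theorem Definable.iSup {F : IntFun V k} (hF : Definable V S P F) :
    Definable V S P (fun s i (_ : Fin 0 → (V s i).M) => ⨆ z, F s i z) := by
  obtain ⟨n, χ, t, h₁, ht, rfl⟩ := hF
  refine ⟨n, χ.exs k, t, (χ.symbols_exs k).trans_subset h₁, ht, ?_⟩
  funext s i z
  rw [← Valuation.value_exs]
  congr 1
  exact (Fin.append_right_nil (fun j => t j s i) z rfl).symm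

theorem Definable.iInf {F : IntFun V k} (hF : Definable V S P F) :
    Definable V S P (fun s i (_ : Fin 0 → (V s i).M) => ⨅ z, F s i z) := by
  obtain ⟨n, χ, t, h₁, ht, rfl⟩ := hF
  refine ⟨n, χ.alls k, t, (χ.symbols_alls k).trans_subset h₁, ht, ?_⟩
  funext s i z
  rw [← Valuation.value_alls]
  congr 1
  exact (Fin.append_right_nil (fun j => t j s i) z rfl).symm

theorem DefPred.exists {p : ∀ s i, (Fin k → (V s i).M) → Prop} (hp : DefPred V S P p) :
    DefPred V S P (fun s i (_ : Fin 0 → (V s i).M) => ∃ z, p s i z) := by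
  have := Definable.iSup hp
  unfold DefPred
  convert this using 1
  funext s i z
  by_cases h : ∃ z, p s i z
  · simp only [crisp, h, if_true]
    obtain ⟨z, hz⟩ := h
    exact le_antisymm (le_iSup_of_le z (by simp [hz])) unitInterval.le_one'
  · simp only [crisp, h, if_false]
    push Not at h
    simp [h]

/-- Restricting an infimum to a definable predicate. -/
theorem Definable.iInf_of {p : ∀ s i, (Fin k → (V s i).M) → Prop} {F : IntFun V k}
    (hp : DefPred V S P p) (hF : Definable V S P F) :
    Definable V S P fun s i (_ : Fin 0 → (V s i).M) => ⨅ z, ⨅ _ : p s i z, F s i z := by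
  have := (Definable.imp hp hF).iInf
  convert this using 6 with s i _ z
  by_cases h : p s i z
  · by_cases h' : F s i z = 1
    · simp [crisp, h, h']
    · have : ¬ 1 ≤ F s i z := fun h₁ => h' (le_antisymm unitInterval.le_one' h₁)
      simp [crisp, h, this]
  · simp [crisp, h]
    rfl

/-- Restricting a supremum to a definable predicate. -/
theorem Definable.iSup_of {p : ∀ s i, (Fin k → (V s i).M) → Prop} {F : IntFun V k}
    (hp : DefPred V S P p) (hF : Definable V S P F) :
    Definable V S P fun s i (_ : Fin 0 → (V s i).M) => ⨆ z, ⨆ _ : p s i z, F s i z := by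
  have := (Definable.min hp hF).iSup
  convert this using 6 with s i _ z
  by_cases h : p s i z
  · simpa [crisp, h] using unitInterval.le_one'
  · simp [crisp, h]
    rfl

/-- A definable function without arguments as a constant function. -/
theorem Definable.const {F : IntFun V 0} (hF : Definable V S P F) :
    Definable V S P (fun s i _ => F s i Fin.elim0 : IntFun V k) := by
  obtain ⟨n, χ, t, h₁, ht, rfl⟩ := hF
  refine ⟨n, χ.subst (fun j => .var (Fin.castAdd k j)), t,
    Formula.symbols_subst _ _ h₁ fun i => by simp [Term.symbols], ht, ?_⟩
  funext s i z
  rw [Valuation.value_subst]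
  simp [Valuation.termValue, Fin.append_elim0]

/-- Constant symbols can be used as parameters. -/
theorem Definable.constSymbol {F : IntFun V 1} (hF : Definable V S P F) {c : L.Const}
    (hc : Sum.inr c ∈ S) :
    Definable V S P (fun s i _ => F s i fun _ => (V s i).const c : IntFun V 0) := by
  obtain ⟨n, χ, t, h₁, ht, rfl⟩ := hF
  refine ⟨n, χ.subst (m := n + 0) (Fin.append (fun j => .var j) fun _ => .const c), t, ?_, ht, ?_⟩
  · refine Formula.symbols_subst _ _ h₁ fun i => ?_
    refine Fin.addCases (fun j => ?_) (fun j => ?_) i <;> simp [Term.symbols, hc]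
  · funext s i z
    rw [Valuation.value_subst]
    refine congrArg ((V s i).value χ) ?_
    funext j
    refine Fin.addCases (fun j => ?_) (fun j => ?_) j
    · simp only [Fin.append_left, Valuation.termValue]
      exact (congrFun (Fin.append_right_nil (fun j => t j s i) z rfl) j).symm
    · simp [Valuation.termValue]

/-- Additional parameters can be replaced by arguments. -/
theorem Definable.abstract {p : Fin k → Point V} {F : IntFun V 0}
    (hF : Definable V S (P ∪ Set.range p) F) :
    ∃ G : IntFun V k, Definable V S P G ∧ ∀ s i, F s i Fin.elim0 = G s i fun j => p j s i := by
  classical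
  obtain ⟨n, χ, t, h₁, ht, rfl⟩ := hF
  let e := Fintype.equivFin {j // t j ∈ P}
  have hp : ∀ j, t j ∉ P → ∃ l, p l = t j := fun j hj => (ht j).resolve_left hj
  let f : Fin n → Fin (Fintype.card {j // t j ∈ P} + k) := fun j =>
    if h : t j ∈ P then Fin.castAdd k (e ⟨j, h⟩) else Fin.natAdd _ (hp j h).choose
  refine ⟨_, ⟨_, χ.subst (n := n) fun j => .var (f j), fun j => t (e.symm j).1,
    Formula.symbols_subst (n := n) _ _ h₁ fun i => by simp [Term.symbols],
    fun j => (e.symm j).2, rfl⟩, fun s i => ?_⟩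
  rw [Valuation.value_subst]
  refine congrArg ((V s i).value χ) ((Fin.append_elim0 _).trans ?_)
  funext j
  by_cases h : t j ∈ P
  · simp [Valuation.termValue, f, h]
  · simp [Valuation.termValue, f, h, (hp j h).choose_spec]

end Definable

/-! ### Order-compatible pairs of nonstandard truth values -/

section Compat

open Filter

theorem Hyper.zero_le (a : Hyper) : 0 ≤ a := by
  induction a using Germ.inductionOn with
  | _ f => exact Germ.coe_le.2 (.of_forall fun i => unitInterval.nonneg')

theorem Hyper.le_one (a : Hyper) : a ≤ 1 := by
  induction a using Germ.inductionOn with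
  | _ f => exact Germ.coe_le.2 (.of_forall fun i => unitInterval.le_one')

theorem Hyper.zero_lt_one : (0 : Hyper) < 1 :=
  Germ.coe_lt.2 (.of_forall fun _ => _root_.zero_lt_one)

theorem Hyper.exists_rep (a : Hyper) : ∃ f : ℕ → unitInterval, (f : Hyper) = a :=
  Quotient.exists_rep a

/-- The order of nonstandard truth values has no countable gaps. -/
theorem Hyper.exists_between {A B : Set Hyper} (hA : A.Countable) (hB : B.Countable)
    (hA₀ : A.Nonempty) (hB₀ : B.Nonempty) (h : ∀ a ∈ A, ∀ b ∈ B, a < b) :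
    ∃ c, (∀ a ∈ A, a < c) ∧ ∀ b ∈ B, c < b := by
  choose f hf using Hyper.exists_rep
  have := hA.to_subtype
  have := hB.to_subtype
  obtain ⟨z, hz⟩ := exists_internal (ι := A × B) (Z := fun _ => unitInterval)
    (fun x i z => f x.1 i < z ∧ z < f x.2 i) (fun x y => by
      have hmax : ∃ a : A, (x.1 : Hyper) ≤ a ∧ (y.1 : Hyper) ≤ a := by
        rcases le_total x.1.1 y.1.1 with h | h
        exacts [⟨y.1, h, le_rfl⟩, ⟨x.1, le_rfl, h⟩]
      have hmin : ∃ b : B, (b : Hyper) ≤ x.2 ∧ (b : Hyper) ≤ y.2 := by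
        rcases le_total x.2.1 y.2.1 with h | h
        exacts [⟨x.2, le_rfl, h⟩, ⟨y.2, h, le_rfl⟩]
      obtain ⟨a, ha₁, ha₂⟩ := hmax
      obtain ⟨b, hb₁, hb₂⟩ := hmin
      refine ⟨(a, b), ?_⟩
      rw [← hf a, ← hf x.1] at ha₁
      rw [← hf a, ← hf y.1] at ha₂
      rw [← hf b, ← hf x.2] at hb₁
      rw [← hf b, ← hf y.2] at hb₂
      filter_upwards [Germ.coe_le.1 ha₁, Germ.coe_le.1 ha₂, Germ.coe_le.1 hb₁,
        Germ.coe_le.1 hb₂] with i h₁ h₂ h₃ h₄ z hz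
      exact ⟨⟨h₁.trans_lt hz.1, hz.2.trans_le h₃⟩, ⟨h₂.trans_lt hz.1, hz.2.trans_le h₄⟩⟩)
    (fun x => by
      have := h _ x.1.2 _ x.2.2
      rw [← hf x.1, ← hf x.2, Germ.coe_lt] at this
      exact this.mono fun i hi => _root_.exists_between hi)
  refine ⟨z, fun a ha => ?_, fun b hb => ?_⟩
  · obtain ⟨b, hb⟩ := hB₀
    rw [← hf a, Germ.coe_lt]
    exact (hz (⟨a, ha⟩, ⟨b, hb⟩)).mono fun i hi => hi.1
  · obtain ⟨a, ha⟩ := hA₀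
    rw [← hf b, Germ.coe_lt]
    exact (hz (⟨a, ha⟩, ⟨b, hb⟩)).mono fun i hi => hi.2

/-- A set of pairs of nonstandard truth values is order-compatible if it is the graph of an
isomorphism between two sets of nonstandard truth values. -/
def Compat (R : Set (Bool → Hyper)) : Prop :=
  ∀ q ∈ R, ∀ q' ∈ R, ∀ s s', q s ≤ q' s → q s' ≤ q' s'

/-- The two entries of the pair `c` realize corresponding cuts in the two sides of `R`. -/
def InCut (R : Set (Bool → Hyper)) (c : Bool → Hyper) : Prop :=
  ∀ q ∈ R, ∀ s s', q s ≠ c s ∧ (q s < c s → q s' < c s')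

variable {R R' : Set (Bool → Hyper)} {c : Bool → Hyper}

theorem InCut.mono (h : InCut R' c) (hR : R ⊆ R') : InCut R c := fun q hq => h q (hR hq)

theorem Compat.lt (h : Compat R) {q q' : Bool → Hyper} (hq : q ∈ R) (hq' : q' ∈ R) {s s' : Bool}
    (hlt : q s < q' s) : q s' < q' s' :=
  lt_of_not_ge fun hle => (h q' hq' q hq s' s hle).not_gt hlt

theorem Compat.ext (h : Compat R) {q q' : Bool → Hyper} (hq : q ∈ R) (hq' : q' ∈ R) {s : Bool}
    (heq : q s = q' s) : q = q' :=
  funext fun s' => le_antisymm (h q hq q' hq' s s' heq.le) (h q' hq' q hq s s' heq.ge)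

theorem Compat.union (h : Compat R) (h' : Compat R') (hc : ∀ c ∈ R', InCut R c) :
    Compat (R ∪ R') := by
  rintro q (hq | hq) q' (hq' | hq') s s' hle
  · exact h q hq q' hq' s s' hle
  · exact ((hc q' hq' q hq s s').2 (lt_of_le_of_ne hle (hc q' hq' q hq s s').1)).le
  · exact le_of_not_gt fun hlt => ((hc q hq q' hq' s' s).2 hlt).not_ge hle
  · exact h' q hq q' hq' s s' hle

theorem compat_singleton (c : Bool → Hyper) : Compat {c} := by
  rintro q rfl q' rfl s s' _
  exact le_rfl

/-- Every nonstandard truth value can be matched with one on the other side. -/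
theorem Compat.exists_inCut (h : Compat R) (hR : R.Countable) (h₀ : (fun _ => 0) ∈ R)
    (h₁ : (fun _ => 1) ∈ R) (s : Bool) (a : Hyper) (ha : ∀ q ∈ R, q s ≠ a) :
    ∃ c, c s = a ∧ InCut R c := by
  obtain ⟨b, hb₁, hb₂⟩ := Hyper.exists_between
    (A := (fun q => q (!s)) '' {q ∈ R | q s < a}) (B := (fun q => q (!s)) '' {q ∈ R | a < q s})
    ((hR.mono (Set.sep_subset _ _)).image _) ((hR.mono (Set.sep_subset _ _)).image _)
    ⟨_, _, ⟨h₀, lt_of_le_of_ne (Hyper.zero_le a) (ha _ h₀)⟩, rfl⟩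
    ⟨_, _, ⟨h₁, lt_of_le_of_ne (Hyper.le_one a) (ha _ h₁).symm⟩, rfl⟩ (by
      rintro _ ⟨q, ⟨hq, hqa⟩, rfl⟩ _ ⟨q', ⟨hq', hqa'⟩, rfl⟩
      exact h.lt hq hq' (hqa.trans hqa'))
  have key : ∀ q ∈ R, (q s < a ∧ q (!s) < b) ∨ (a < q s ∧ b < q (!s)) := by
    intro q hq
    rcases lt_or_gt_of_ne (ha q hq) with hlt | hgt
    · exact .inl ⟨hlt, hb₁ _ ⟨q, ⟨hq, hlt⟩, rfl⟩⟩
    · exact .inr ⟨hgt, hb₂ _ ⟨q, ⟨hq, hgt⟩, rfl⟩⟩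
  have key' : ∀ q ∈ R, (∀ t, q t < if t = s then a else b) ∨ ∀ t, (if t = s then a else b) < q t := by
    intro q hq
    refine (key q hq).imp (fun hk t => ?_) (fun hk t => ?_) <;>
    · by_cases hts : t = s
      · subst hts; simpa using hk.1
      · obtain rfl : t = !s := by cases t <;> cases s <;> simp_all
        simpa using hk.2
  refine ⟨fun t => if t = s then a else b, by simp, fun q hq t t' => ?_⟩
  rcases key' q hq with hk | hk
  · exact ⟨(hk t).ne, fun _ => hk t'⟩
  · exact ⟨(hk t).ne', fun hlt => absurd hlt (hk t).not_gt⟩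

end Compat

/-! ### Approximations and their extensions -/

section Approx

open Filter

variable {L : RelLanguage.{u, v}} (V : Bool → ℕ → Valuation.{u, v, w} L) (S : Set L.Symbol)

/-- The correspondence between the two ultraproducts given by the points of `P` preserves the truth
of all formulas with symbols in `S`. -/
def PartialIso (P : Set (Point V)) : Prop :=
  ∀ F : IntFun V 0, Definable V S P F → ∀ s s', (∀ᶠ i in hyperfilter ℕ, F s i Fin.elim0 = 1) →
    ∀ᶠ i in hyperfilter ℕ, F s' i Fin.elim0 = 1

/-- The pairs of values of formulas with symbols in `S` and parameters in `P`. -/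
def defValues (P : Set (Point V)) : Set (Bool → Hyper) :=
  {q | ∃ F : IntFun V 0, Definable V S P F ∧ q = F.germ}

/-- A pair `q` of nonstandard truth values is isolated over `P` if the values of each formula with
symbols in `S` stay out of an interval around `q` that is definable over `P`. -/
def Isolated (P : Set (Point V)) (q : Bool → Hyper) : Prop :=
  ∀ (k : ℕ) (r : IntFun V k), Definable V S ∅ r →
    ∃ d ∈ defValues V S P, ∃ e ∈ defValues V S P, (∀ s, d s < q s ∧ q s < e s) ∧
      ∀ s (z : ∀ i, Fin k → (V s i).M),
        ¬ (d s < ((fun i => r s i (z i) : ℕ → unitInterval) : Hyper) ∧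
          ((fun i => r s i (z i) : ℕ → unitInterval) : Hyper) < e s)

/-- A countable approximation to a common model: a partial isomorphism `P` between the two
ultraproducts, with a set `Q` of further pairs of truth values that are to be identified.
The latter are required to be isolated, so that extensions of `P` never interfere with them. -/
structure Approx (P : Set (Point V)) (Q : Set (Bool → Hyper)) : Prop where
  countable_left : P.Countable
  countable_right : Q.Countable
  partialIso : PartialIso V S P
  compat : Compat Q
  isolated : ∀ q ∈ Q, Isolated V S P q

variable {V S} {P P' : Set (Point V)} {Q : Set (Bool → Hyper)} {k : ℕ}

theorem germ_le_iff {f g : ℕ → unitInterval} :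
    (f : Hyper) ≤ g ↔ ∀ᶠ i in hyperfilter ℕ, f i ≤ g i := Germ.coe_le

theorem germ_lt_iff {f g : ℕ → unitInterval} :
    (f : Hyper) < g ↔ ∀ᶠ i in hyperfilter ℕ, f i < g i := Germ.coe_lt

theorem PartialIso.pred (h : PartialIso V S P) {p : ∀ s i, (Fin 0 → (V s i).M) → Prop}
    (hp : DefPred V S P p) (s s' : Bool) (hs : ∀ᶠ i in hyperfilter ℕ, p s i Fin.elim0) :
    ∀ᶠ i in hyperfilter ℕ, p s' i Fin.elim0 := by
  refine (h _ hp s s' (hs.mono fun i hi => by simp [crisp, hi])).mono fun i hi => ?_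
  by_contra hn
  simp [crisp, hn] at hi

theorem defValues.mono (h : P ⊆ P') : defValues V S P ⊆ defValues V S P' :=
  fun _ ⟨F, hF, hq⟩ => ⟨F, hF.mono h, hq⟩

theorem zero_mem_defValues : (fun _ => 0) ∈ defValues V S P := ⟨_, .bot, rfl⟩

theorem one_mem_defValues : (fun _ => 1) ∈ defValues V S P := ⟨_, .top, rfl⟩

theorem defValues.countable [∀ k, Countable (L.Rel k)] [Countable L.Const] (hP : P.Countable) :
    (defValues V S P).Countable := by
  refine ((Definable.countable (S := S) (k := 0) hP).image IntFun.germ).mono ?_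
  rintro q ⟨F, hF, rfl⟩
  exact ⟨F, hF, rfl⟩

theorem PartialIso.compat (h : PartialIso V S P) : Compat (defValues V S P) := by
  rintro _ ⟨F, hF, rfl⟩ _ ⟨G, hG, rfl⟩ s s' hle
  exact germ_le_iff.2 (h.pred (hF.le hG) s s' (germ_le_iff.1 hle))

theorem Isolated.mono {q : Bool → Hyper} (h : Isolated V S P q) (hP : P ⊆ P') :
    Isolated V S P' q := by
  intro k r hr
  obtain ⟨d, hd, e, he, h⟩ := h k r hr
  exact ⟨d, defValues.mono hP hd, e, defValues.mono hP he, h⟩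

theorem Isolated.inCut {q : Bool → Hyper} (h : Isolated V S P q) (hP : PartialIso V S P) :
    InCut (defValues V S P) q := by
  rintro _ ⟨F, hF, rfl⟩ s s'
  obtain ⟨n, χ, t, hχ, ht, hF'⟩ := id hF
  have hF'' : Definable V S (∅ ∪ Set.range t) F :=
    ⟨n, χ, t, hχ, fun j => .inr ⟨j, rfl⟩, hF'⟩
  obtain ⟨r, hr, hFr⟩ := hF''.abstract
  obtain ⟨d, hd, e, he, hq, hne⟩ := h n r hr
  have hFs : F.germ s = ((fun i => r s i (fun j => t j s i) : ℕ → unitInterval) : Hyper) := by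
    simp only [IntFun.germ, hFr]
  have hdich : F.germ s ≤ d s ∨ e s ≤ F.germ s := by
    by_contra! hcon
    exact hne s (fun i j => t j s i) (hFs ▸ hcon)
  rcases hdich with hle | hle
  · exact ⟨(hle.trans_lt (hq s).1).ne, fun _ =>
      (hP.compat _ ⟨F, hF, rfl⟩ d hd s s' hle).trans_lt (hq s').1⟩
  · exact ⟨((hq s).2.trans_le hle).ne', fun hlt => absurd hlt ((hq s).2.trans_le hle).not_gt⟩

theorem Approx.compat_union (h : Approx V S P Q) : Compat (defValues V S P ∪ Q) :=
  h.partialIso.compat.union h.compat fun q hq => (h.isolated q hq).inCut h.partialIso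

variable [∀ k, Countable (L.Rel k)] [Countable L.Const]

/-- Extension of a partial isomorphism by a tuple. The new tuple has the type of a given tuple `z₀`
of one ultraproduct, and satisfies internal conditions `E` that are consistent with this type.
That `P` is a partial isomorphism is part of `hE`. -/
theorem exists_realization (hP : P.Countable) {s₀ : Bool}
    (z₀ : ∀ i, Fin k → (V s₀ i).M) (E : ∀ s i, (Fin k → (V s i).M) → Prop)
    (hE : ∀ s p, DefPred V S P p → (∀ᶠ i in hyperfilter ℕ, p s₀ i (z₀ i)) →
      ∀ᶠ i in hyperfilter ℕ, ∃ z, p s i z ∧ E s i z) :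
    ∃ t : Fin k → Point V, PartialIso V S (P ∪ Set.range t) ∧
      ∀ s, ∀ᶠ i in hyperfilter ℕ, E s i fun j => t j s i := by
  let T : Set (∀ s i, (Fin k → (V s i).M) → Prop) :=
    {p | DefPred V S P p ∧ ∀ᶠ i in hyperfilter ℕ, p s₀ i (z₀ i)}
  have hT : T.Countable := (DefPred.countable hP).mono fun p hp => hp.1
  have := hT.to_subtype
  have hz : ∀ s, ∃ z : ∀ i, Fin k → (V s i).M, ∀ p : T, ∀ᶠ i in hyperfilter ℕ,
      p.1 s i (z i) ∧ E s i (z i) := fun s =>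
    exists_internal (ι := T) (fun p i z => p.1 s i z ∧ E s i z)
      (fun p q => ⟨⟨_, p.2.1.and q.2.1, p.2.2.and q.2.2⟩, .of_forall fun i z hz =>
        ⟨⟨hz.1.1, hz.2⟩, ⟨hz.1.2, hz.2⟩⟩⟩)
      (fun p => hE s p.1 p.2.1 p.2.2)
  choose z hz using hz
  refine ⟨fun j s i => z s i j, fun F hF s s' hs => ?_, fun s => ?_⟩
  · obtain ⟨G, hG, hFG⟩ := hF.abstract
    simp only [hFG] at hs ⊢
    by_cases hG₀ : ∀ᶠ i in hyperfilter ℕ, G s₀ i (z₀ i) = 1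
    · exact (hz s' ⟨_, hG.eq_one, hG₀⟩).mono fun i hi => hi.1
    · have := hz s ⟨_, hG.eq_one.not, Ultrafilter.eventually_not.2 hG₀⟩
      obtain ⟨i, hi₁, hi₂⟩ := (hs.and this).exists
      exact absurd hi₁ hi₂.1
  · exact (hz s ⟨_, Definable.top.eq_one, .of_forall fun _ => rfl⟩).mono fun i hi => hi.2

/-- If a pair `c` fills corresponding cuts in the two sides, it can either be added to the set of
pairs to be identified, or be separated by a definable value, in the direction that one likes. -/
theorem Approx.separate (h : Approx V S P Q) {c : Bool → Hyper}
    (hc : InCut (defValues V S P ∪ Q) c) (s₁ : Bool) :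
    ∃ P' Q', P ⊆ P' ∧ Q ⊆ Q' ∧ Approx V S P' Q' ∧
      (c ∈ Q' ∨ ∃ r ∈ defValues V S P', r s₁ < c s₁ ∧ c (!s₁) < r (!s₁)) := by
  have hcP : InCut (defValues V S P) c := hc.mono Set.subset_union_left
  by_cases hiso : Isolated V S P c
  · refine ⟨P, Q ∪ {c}, subset_rfl, Set.subset_union_left, ⟨h.countable_left,
      h.countable_right.union (Set.countable_singleton c), h.partialIso, ?_, ?_⟩, .inl (by simp)⟩
    · refine h.compat.union (compat_singleton c) ?_
      rintro _ rfl
      exact hc.mono Set.subset_union_right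
    · rintro q (hq | rfl)
      exacts [h.isolated q hq, hiso]
  simp only [Isolated, not_forall, not_exists, not_and, not_not] at hiso
  obtain ⟨k, r, hr, hne⟩ := hiso
  have hr' : Definable V S P r := hr.mono (Set.empty_subset P)
  -- some values of `r` in the side `s₁` fill the cut
  have hz₀ : ∃ z₀ : ∀ i, Fin k → (V s₁ i).M, ∀ D E : IntFun V 0, Definable V S P D →
      Definable V S P E → D.germ s₁ < c s₁ → c s₁ < E.germ s₁ → ∀ᶠ i in hyperfilter ℕ,
        D s₁ i Fin.elim0 < r s₁ i (z₀ i) ∧ r s₁ i (z₀ i) < E s₁ i Fin.elim0 := by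
    let D : Set (IntFun V 0) := {D | Definable V S P D ∧ D.germ s₁ < c s₁}
    let E : Set (IntFun V 0) := {E | Definable V S P E ∧ c s₁ < E.germ s₁}
    have hD : D.Countable := (Definable.countable h.countable_left).mono fun p hp => hp.1
    have hE : E.Countable := (Definable.countable h.countable_left).mono fun p hp => hp.1
    have := hD.to_subtype
    have := hE.to_subtype
    obtain ⟨z, hz⟩ := exists_internal (ι := D × E) (Z := fun i => Fin k → (V s₁ i).M)
      (fun x i z => x.1.1 s₁ i Fin.elim0 < r s₁ i z ∧ r s₁ i z < x.2.1 s₁ i Fin.elim0)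
      (fun x y => by
        have hmax : ∃ a : D, x.1.1.germ s₁ ≤ a.1.germ s₁ ∧ y.1.1.germ s₁ ≤ a.1.germ s₁ := by
          rcases le_total (x.1.1.germ s₁) (y.1.1.germ s₁) with h | h
          exacts [⟨y.1, h, le_rfl⟩, ⟨x.1, le_rfl, h⟩]
        have hmin : ∃ b : E, b.1.germ s₁ ≤ x.2.1.germ s₁ ∧ b.1.germ s₁ ≤ y.2.1.germ s₁ := by
          rcases le_total (x.2.1.germ s₁) (y.2.1.germ s₁) with h | h
          exacts [⟨x.2, le_rfl, h⟩, ⟨y.2, h, le_rfl⟩]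
        obtain ⟨a, ha₁, ha₂⟩ := hmax
        obtain ⟨b, hb₁, hb₂⟩ := hmin
        refine ⟨(a, b), ?_⟩
        filter_upwards [germ_le_iff.1 ha₁, germ_le_iff.1 ha₂, germ_le_iff.1 hb₁,
          germ_le_iff.1 hb₂] with i h₁ h₂ h₃ h₄ z hz
        exact ⟨⟨h₁.trans_lt hz.1, hz.2.trans_le h₃⟩, ⟨h₂.trans_lt hz.1, hz.2.trans_le h₄⟩⟩)
      (fun ⟨⟨D, hD, hDc⟩, ⟨E, hE, hEc⟩⟩ => by
        obtain ⟨s, z, hz₁, hz₂⟩ := hne D.germ ⟨D, hD, rfl⟩ E.germ ⟨E, hE, rfl⟩ fun s =>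
          ⟨(hcP _ ⟨D, hD, rfl⟩ s₁ s).2 hDc, lt_of_not_ge fun hle => hEc.not_gt
            ((hcP _ ⟨E, hE, rfl⟩ s s₁).2 (lt_of_le_of_ne hle (hcP _ ⟨E, hE, rfl⟩ s s₁).1))⟩
        refine h.partialIso.pred (((Definable.const hD).lt hr').and
          (hr'.lt (Definable.const hE))).exists s s₁ ?_
        filter_upwards [germ_lt_iff.1 hz₁, germ_lt_iff.1 hz₂] with i h₁ h₂
        exact ⟨z i, h₁, h₂⟩)
    exact ⟨z, fun D' E' hD' hE' hDc hEc => hz (⟨D', hD', hDc⟩, ⟨E', hE', hEc⟩)⟩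
  obtain ⟨z₀, hz₀⟩ := hz₀
  choose f hf using fun s => (c s).exists_rep
  obtain ⟨t, ht, htE⟩ := exists_realization h.countable_left z₀
    (fun s i z => (s = s₁ → r s i z < f s i) ∧ (s = (!s₁) → f s i < r s i z)) (by
      intro s p hp hps
      by_contra hcon
      rw [← Ultrafilter.eventually_not] at hcon
      by_cases hs : s = s₁
      · subst hs
        -- otherwise the infimum of `r` on `p` would lie above `c`, but not above `r z₀`
        have hI := Definable.iInf_of hp hr'
        have hle : f s ≤ᶠ[hyperfilter ℕ] fun i => ⨅ z, ⨅ _ : p s i z, r s i z :=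
          hcon.mono fun i hi => le_iInf fun z => le_iInf fun hz => by
            by_contra! hlt
            exact hi ⟨z, hz, fun _ => hlt, by simp⟩
        have hcI := hcP _ ⟨_, hI, rfl⟩ s s
        have hlt := lt_of_le_of_ne (hf s ▸ germ_le_iff.2 hle) hcI.1.symm
        obtain ⟨i, hi, hi'⟩ := ((hz₀ _ _ .bot hI
          (lt_of_le_of_ne (Hyper.zero_le _) (hcP _ zero_mem_defValues s s).1) hlt).and hps).exists
        exact hi.2.not_ge (iInf₂_le (z₀ i) hi')
      · obtain rfl : s = !s₁ := by cases s <;> cases s₁ <;> simp_all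
        have hI := Definable.iSup_of hp hr'
        have hle : (fun i => ⨆ z, ⨆ _ : p (!s₁) i z, r (!s₁) i z) ≤ᶠ[hyperfilter ℕ] f (!s₁) :=
          hcon.mono fun i hi => iSup_le fun z => iSup_le fun hz => by
            by_contra! hlt
            exact hi ⟨z, hz, by simp, fun _ => hlt⟩
        have hcI := hcP _ ⟨_, hI, rfl⟩ (!s₁) s₁
        have hlt := hcI.2 (lt_of_le_of_ne (hf (!s₁) ▸ germ_le_iff.2 hle) hcI.1)
        obtain ⟨i, hi, hi'⟩ := ((hz₀ _ _ hI .top hlt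
          (lt_of_le_of_ne (Hyper.le_one _) (hcP _ one_mem_defValues s₁ s₁).1.symm)).and hps).exists
        exact hi.1.not_ge (le_iSup₂ (f := fun z (_ : p s₁ i z) => r s₁ i z) (z₀ i) hi'))
  have hrt : (fun s => ((fun i => r s i fun j => t j s i : ℕ → unitInterval) : Hyper)) ∈
      defValues V S (P ∪ Set.range t) := by
    obtain ⟨n, χ, a, hχ, ha, rfl⟩ := hr
    refine ⟨_, ⟨n + k, χ, Fin.append a t, hχ, fun j => ?_, rfl⟩, ?_⟩
    · refine Fin.addCases (fun j => ?_) (fun j => ?_) j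
      · exact (ha j).elim
      · simp
    · funext s
      refine congrArg _ (funext fun i => congrArg ((V s i).value χ) ?_)
      refine Eq.trans ?_ (Fin.append_elim0 _).symm
      funext j
      refine Fin.addCases (fun j => ?_) (fun j => ?_) j <;> simp
  refine ⟨P ∪ Set.range t, Q, Set.subset_union_left, subset_rfl, ⟨h.countable_left.union
    (Set.countable_range t), h.countable_right, ht, h.compat, fun q hq => (h.isolated q hq).mono
      Set.subset_union_left⟩, .inr ⟨_, hrt, ?_, ?_⟩⟩
  · rw [← hf s₁]
    exact germ_lt_iff.2 ((htE s₁).mono fun i hi => hi.1 rfl)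
  · rw [← hf (!s₁)]
    exact germ_lt_iff.2 ((htE (!s₁)).mono fun i hi => hi.2 rfl)

end Approx

/-! ### Bookkeeping -/

/-- Each state comes with countably many tasks, and every later state can be extended so as to
fulfil any of them. Then there is a sequence of extensions in which all tasks get fulfilled. -/
theorem exists_chain {σ : Type*} [Preorder σ] (T : σ → Set (σ → Prop))
    (hT : ∀ s, (T s).Countable)
    (step : ∀ s s', s ≤ s' → ∀ D ∈ T s, ∃ s'', s' ≤ s'' ∧ D s'') (s₀ : σ) :
    ∃ c : ℕ → σ, c 0 = s₀ ∧ Monotone c ∧ ∀ m, ∀ D ∈ T (c m), ∃ n, D (c n) := by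
  have henum : ∀ s, ∃ f : ℕ → σ → Prop, T s ⊆ Set.range f := by
    intro s
    obtain ⟨f, hf⟩ := ((hT s).insert fun _ => True).exists_eq_range (Set.insert_nonempty _ _)
    exact ⟨f, (Set.subset_insert _ _).trans hf.subset⟩
  choose f hf using henum
  have hnext : ∀ s s' k, ∃ s'', s' ≤ s'' ∧ (s ≤ s' → f s k ∈ T s → f s k s'') := by
    intro s s' k
    by_cases h : s ≤ s' ∧ f s k ∈ T s
    · obtain ⟨s'', h₁, h₂⟩ := step s s' h.1 _ h.2
      exact ⟨s'', h₁, fun _ _ => h₂⟩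
    · exact ⟨s', le_rfl, fun h₁ h₂ => absurd ⟨h₁, h₂⟩ h⟩
  choose next hle hnext using hnext
  -- `w n` lists the states up to stage `n`; stage `n + 1` treats task `j` of stage `i`, where
  -- `n` codes the pair `(i, j)`
  let w : ℕ → ℕ → σ := fun n => Nat.rec (fun _ => s₀)
    (fun n w => Function.update w (n + 1) (next (w n.unpair.1) (w n) n.unpair.2)) n
  have hw : ∀ n, w (n + 1) =
      Function.update (w n) (n + 1) (next (w n n.unpair.1) (w n n) n.unpair.2) := fun n => rfl
  have hw' : ∀ m n, m ≤ n → w n m = w m m := by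
    intro m n hmn
    induction n, hmn using Nat.le_induction with
    | base => rfl
    | succ n hmn ih => rw [hw, Function.update_of_ne (by omega), ih]
  have hstep : ∀ n, w (n + 1) (n + 1) =
      next (w n.unpair.1 n.unpair.1) (w n n) n.unpair.2 := by
    intro n
    rw [hw, Function.update_self, hw' _ _ n.unpair_left_le]
  have hmono : Monotone fun n => w n n :=
    monotone_nat_of_le_succ fun n => by simpa only [hstep] using hle _ _ _
  refine ⟨fun n => w n n, rfl, hmono, fun m D hD => ?_⟩
  obtain ⟨k, rfl⟩ := hf _ hD
  refine ⟨Nat.pair m k + 1, ?_⟩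
  have h := hnext (w m m) (w (Nat.pair m k) (Nat.pair m k)) k (hmono (Nat.left_le_pair m k)) hD
  simpa only [hstep, Nat.unpair_pair] using h

/-! ### Embedding countable linear orders into the unit interval -/

theorem exists_dense_embedding (D : Type*) [LinearOrder D] [BoundedOrder D] [Nontrivial D]
    [Countable D] [DenselyOrdered D] :
    ∃ j : D → unitInterval, StrictMono j ∧ j ⊥ = 0 ∧ j ⊤ = 1 ∧
      ∀ a b, a < b → ∃ d, a < j d ∧ j d < b := by
  have : Nonempty (Set.Ioo (⊥ : D) ⊤) := (Set.nonempty_Ioo.2 bot_lt_top).to_subtype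
  have : Nonempty (Set.Ioo (0 : ℚ) 1) := (Set.nonempty_Ioo.2 zero_lt_one).to_subtype
  obtain ⟨g⟩ := Order.iso_of_countable_dense (Set.Ioo (⊥ : D) ⊤) (Set.Ioo (0 : ℚ) 1)
  have hI : ∀ q : Set.Ioo (0 : ℚ) 1, ((q : ℚ) : ℝ) ∈ unitInterval := fun q =>
    ⟨by exact_mod_cast q.2.1.le, by exact_mod_cast q.2.2.le⟩
  classical
  let j : D → unitInterval := fun d =>
    if h₀ : d = ⊥ then 0 else if h₁ : d = ⊤ then 1 else
      ⟨_, hI (g ⟨d, bot_lt_iff_ne_bot.2 h₀, lt_top_iff_ne_top.2 h₁⟩)⟩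
  have hj : ∀ d : Set.Ioo (⊥ : D) ⊤, j d = ⟨_, hI (g d)⟩ := fun d => by
    simp [j, d.2.1.ne', d.2.2.ne]
  have hbot : j ⊥ = 0 := by simp [j]
  have htop : j ⊤ = 1 := by simp [j]
  have hpos : ∀ d : Set.Ioo (⊥ : D) ⊤, 0 < j d ∧ j d < 1 := fun d => by
    rw [hj]
    exact ⟨show (0 : ℝ) < ((g d : ℚ) : ℝ) by exact_mod_cast (g d).2.1,
      show ((g d : ℚ) : ℝ) < 1 by exact_mod_cast (g d).2.2⟩
  refine ⟨j, fun d e hde => ?_, hbot, htop, fun a b hab => ?_⟩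
  · rcases eq_or_ne d ⊥ with rfl | hd
    · rw [hbot]
      rcases eq_or_ne e ⊤ with rfl | he
      · rw [htop]; exact zero_lt_one
      · exact (hpos ⟨e, hde, lt_top_iff_ne_top.2 he⟩).1
    · have hd' : d ∈ Set.Ioo (⊥ : D) ⊤ := ⟨bot_lt_iff_ne_bot.2 hd, hde.trans_le le_top⟩
      rcases eq_or_ne e ⊤ with rfl | he
      · rw [htop]; exact (hpos ⟨d, hd'⟩).2
      · have he' : e ∈ Set.Ioo (⊥ : D) ⊤ := ⟨bot_le.trans_lt hde, lt_top_iff_ne_top.2 he⟩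
        have : g ⟨d, hd'⟩ < g ⟨e, he'⟩ := g.strictMono hde
        rw [hj ⟨d, hd'⟩, hj ⟨e, he'⟩]
        exact show ((g ⟨d, hd'⟩ : ℚ) : ℝ) < ((g ⟨e, he'⟩ : ℚ) : ℝ) by exact_mod_cast this
  · obtain ⟨q, hq₁, hq₂⟩ := exists_rat_btwn (show (a : ℝ) < b from hab)
    have hq : q ∈ Set.Ioo (0 : ℚ) 1 :=
      ⟨by exact_mod_cast a.2.1.trans_lt hq₁, by exact_mod_cast hq₂.trans_le b.2.2⟩
    refine ⟨g.symm ⟨q, hq⟩, ?_, ?_⟩ <;> rw [hj, ← Subtype.coe_lt_coe] <;> simpa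

/-- A countable linear order embeds into the unit interval in such a way that all existing suprema
and infima are preserved: insert a copy of the positive rationals into each jump, and use Cantor's
theorem on the resulting dense order. -/
theorem exists_continuous_embedding (B : Type*) [LinearOrder B] [BoundedOrder B] [Nontrivial B]
    [Countable B] :
    ∃ j : B → unitInterval, StrictMono j ∧ j ⊥ = 0 ∧ j ⊤ = 1 ∧
      (∀ X x, IsLUB X x → IsLUB (j '' X) (j x)) ∧ ∀ X x, IsGLB X x → IsGLB (j '' X) (j x) := by
  let D := {x : B ×ₗ ℚ // (ofLex x).2 = 0 ∨ (0 < (ofLex x).2 ∧ ∃ y, (ofLex x).1 ⋖ y)}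
  let ι : B → D := fun x => ⟨toLex (x, 0), .inl rfl⟩
  have hlt : ∀ x y : D, x < y ↔ (ofLex x.1).1 < (ofLex y.1).1 ∨
      (ofLex x.1).1 = (ofLex y.1).1 ∧ (ofLex x.1).2 < (ofLex y.1).2 := fun x y =>
    Prod.Lex.lt_iff
  have hnn : ∀ x : D, 0 ≤ (ofLex x.1).2 := fun x => x.2.elim (fun h => h.ge) fun h => h.1.le
  have hι : StrictMono ι := fun x y h => (hlt _ _).2 (.inl h)
  let _ : BoundedOrder D :=
    { bot := ι ⊥
      top := ι ⊤
      bot_le := fun x => le_of_not_gt fun h => by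
        rcases (hlt _ _).1 h with h | h
        · exact not_lt_bot h
        · exact (hnn x).not_gt h.2
      le_top := fun x => le_of_not_gt fun h => by
        rcases (hlt _ _).1 h with h | ⟨h, h'⟩
        · exact not_top_lt h
        · rcases x.2 with h₀ | ⟨-, y, hy⟩
          · exact h'.ne' h₀
          · exact not_top_lt (h.trans_lt hy.lt) }
  have : Countable D := by
    have : Countable (B ×ₗ ℚ) := inferInstanceAs (Countable (B × ℚ))
    infer_instance
  have : Nontrivial D := hι.injective.nontrivial
  have : DenselyOrdered D := ⟨fun x y hxy => by
    rcases (hlt _ _).1 hxy with h | ⟨h, h'⟩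
    · by_cases hcov : (ofLex x.1).1 ⋖ (ofLex y.1).1
      · have := hnn x
        exact ⟨⟨toLex ((ofLex x.1).1, (ofLex x.1).2 + 1), .inr ⟨by simp; linarith, _, hcov⟩⟩,
          (hlt _ _).2 (.inr ⟨rfl, by simp⟩), (hlt _ _).2 (.inl h)⟩
      · obtain ⟨z, hz₁, hz₂⟩ := exists_lt_lt_of_not_covBy h hcov
        exact ⟨ι z, (hlt _ _).2 (.inl hz₁), (hlt _ _).2 (.inl hz₂)⟩
    · have hx := hnn x
      have hy : ∃ z, (ofLex x.1).1 ⋖ z := by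
        rcases y.2 with h₀ | ⟨-, hy⟩
        · exact absurd (h'.trans_eq h₀) hx.not_gt
        · exact h ▸ hy
      refine ⟨⟨toLex ((ofLex x.1).1, ((ofLex x.1).2 + (ofLex y.1).2) / 2), .inr ⟨?_, hy⟩⟩,
          (hlt _ _).2 (.inr ⟨rfl, ?_⟩), (hlt _ _).2 (.inr ⟨h, ?_⟩)⟩ <;> simp <;> linarith⟩
  obtain ⟨j, hj, hj₀, hj₁, hdense⟩ := exists_dense_embedding D
  refine ⟨j ∘ ι, hj.comp hι, hj₀, hj₁, fun X x hx => ⟨?_, fun b hb => ?_⟩,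
    fun X x hx => ⟨?_, fun b hb => ?_⟩⟩
  · rintro _ ⟨y, hy, rfl⟩
    exact (hj.comp hι).monotone (hx.1 hy)
  · by_contra! hlt'
    obtain ⟨d, hd₁, hd₂⟩ := hdense _ _ hlt'
    have hdx : (ofLex d.1).1 < x := by
      rcases (hlt _ _).1 (hj.lt_iff_lt.1 hd₂) with h | h
      · exact h
      · exact absurd h.2 (hnn d).not_gt
    refine hdx.not_ge (hx.2 fun y hy => ?_)
    have : ι y < d := hj.lt_iff_lt.1 ((hb ⟨y, hy, rfl⟩).trans_lt hd₁)
    rcases (hlt _ _).1 this with h | h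
    exacts [h.le, h.1.le]
  · rintro _ ⟨y, hy, rfl⟩
    exact (hj.comp hι).monotone (hx.1 hy)
  · by_contra! hlt'
    obtain ⟨d, hd₁, hd₂⟩ := hdense _ _ hlt'
    have hdX : ∀ y ∈ X, (ofLex d.1).1 < y := fun y hy => by
      rcases (hlt _ _).1 (hj.lt_iff_lt.1 (hd₂.trans_le (hb ⟨y, hy, rfl⟩))) with h | h
      · exact h
      · exact absurd h.2 (hnn d).not_gt
    have hle : (ofLex d.1).1 ≤ x := hx.2 fun y hy => (hdX y hy).le
    rcases (hlt _ _).1 (hj.lt_iff_lt.1 hd₁) with h | ⟨h, h'⟩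
    · exact hle.not_gt h
    · -- `d` lies in the jump above `x`, so the elements of `X` lie above that jump
      rcases d.2 with h₀ | ⟨-, y, hy⟩
      · exact h'.ne' h₀
      · have hyx : y ≤ x := hx.2 fun y' hy' => hy.ge_of_gt (hdX y' hy')
        exact (hyx.trans h.le).not_gt hy.lt

/-! ### The amalgam -/

section Amalgam

open Filter

variable {L : RelLanguage.{u, v}} {V : Bool → ℕ → Valuation.{u, v, w} L} {S : Set L.Symbol}
  {P : Set (Point V)} {Q : Set (Bool → Hyper)}

/-- The values of formulas with parameters in `P` in the ultraproduct `s`. -/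
def values (V : Bool → ℕ → Valuation.{u, v, w} L) (s : Bool) (P : Set (Point V)) : Set Hyper :=
  {a | ∃ (n : ℕ) (χ : Formula L n) (t : Fin n → Point V), (∀ j, t j ∈ P) ∧ a = val V s χ t}

theorem val_snoc {s : Bool} {n : ℕ} (χ : Formula L (n + 1)) (t : Fin n → Point V) (p : Point V) :
    val V s χ (Fin.snoc t p) = ((fun i => (V s i).value χ (Fin.snoc (fun j => t j s i) (p s i)) :
      ℕ → unitInterval) : Hyper) := by
  have : ∀ i, (fun j => (Fin.snoc t p : Fin (n + 1) → Point V) j s i) =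
      (Fin.snoc (fun j => t j s i) (p s i) : Fin (n + 1) → (V s i).M) := fun i => by
    funext j
    refine Fin.lastCases ?_ (fun j => ?_) j <;> simp
  simp only [val, this]

variable [∀ k, Countable (L.Rel k)] [Countable L.Const]

theorem values.countable (hP : P.Countable) (s : Bool) : (values V s P).Countable := by
  have := hP.to_subtype
  refine (Set.countable_range fun x : Σ n, Formula L n × (Fin n → P) =>
    val V s x.2.1 fun j => x.2.2 j).mono ?_
  rintro _ ⟨n, χ, t, ht, rfl⟩
  exact ⟨⟨n, χ, fun j => ⟨t j, ht j⟩⟩, rfl⟩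

/-- Adjoining a point whose entry in the ultraproduct `s` satisfies an internal condition `e`. -/
theorem Approx.adjoin (h : Approx V S P Q) {s : Bool} (e : ∀ i, (V s i).M → Prop)
    (x : ∀ i, (V s i).M) (hx : ∀ᶠ i in hyperfilter ℕ, e i (x i)) :
    ∃ p : Point V, Approx V S (P ∪ {p}) Q ∧ ∀ᶠ i in hyperfilter ℕ, e i (p s i) := by
  obtain ⟨t, ht, htE⟩ := exists_realization (S := S) (k := 1) h.countable_left (fun i _ => x i)
    (fun s' i z => ∀ hs : s' = s, e i (hs ▸ z 0)) (by
      intro s' p hp hpx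
      by_cases hs : s' = s
      · subst hs
        filter_upwards [hpx, hx] with i h₁ h₂
        exact ⟨_, h₁, fun _ => h₂⟩
      · refine (h.partialIso.pred hp.exists s s' (hpx.mono fun i hi => ⟨_, hi⟩)).mono ?_
        rintro i ⟨z, hz⟩
        exact ⟨z, hz, fun hs' => absurd hs' hs⟩)
  have hr : Set.range t = {t 0} := by
    rw [Set.range_unique]
    rfl
  rw [hr] at ht
  exact ⟨t 0, ⟨h.countable_left.union (Set.countable_singleton _), h.countable_right, ht, h.compat,
    fun q hq => (h.isolated q hq).mono Set.subset_union_left⟩, (htE s).mono fun i hi => hi rfl⟩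

theorem Approx.exists_ex (h : Approx V S P Q) {s : Bool} {n : ℕ} (χ : Formula L (n + 1))
    (t : Fin n → Point V) {g : Hyper} (hg : g < val V s (.ex χ) t) :
    ∃ p : Point V, Approx V S (P ∪ {p}) Q ∧ g < val V s χ (Fin.snoc t p) := by
  obtain ⟨f, rfl⟩ := g.exists_rep
  have hx : ∀ i, ∃ x, f i < (V s i).value (.ex χ) (fun j => t j s i) →
      f i < (V s i).value χ (Fin.snoc (fun j => t j s i) x) := by
    intro i
    by_cases hi : f i < (V s i).value (.ex χ) (fun j => t j s i)
    · obtain ⟨x, hx⟩ := lt_iSup_iff.1 hi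
      exact ⟨x, fun _ => hx⟩
    · exact ⟨Classical.arbitrary _, fun h => absurd h hi⟩
  choose x hx using hx
  obtain ⟨p, hp, hpe⟩ := h.adjoin
    (fun i x => f i < (V s i).value χ (Fin.snoc (fun j => t j s i) x)) x
    ((germ_lt_iff.1 hg).mono fun i hi => hx i hi)
  exact ⟨p, hp, by rw [val_snoc]; exact germ_lt_iff.2 hpe⟩

theorem Approx.exists_all (h : Approx V S P Q) {s : Bool} {n : ℕ} (χ : Formula L (n + 1))
    (t : Fin n → Point V) {g : Hyper} (hg : val V s (.all χ) t < g) :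
    ∃ p : Point V, Approx V S (P ∪ {p}) Q ∧ val V s χ (Fin.snoc t p) < g := by
  obtain ⟨f, rfl⟩ := g.exists_rep
  have hx : ∀ i, ∃ x, (V s i).value (.all χ) (fun j => t j s i) < f i →
      (V s i).value χ (Fin.snoc (fun j => t j s i) x) < f i := by
    intro i
    by_cases hi : (V s i).value (.all χ) (fun j => t j s i) < f i
    · obtain ⟨x, hx⟩ := iInf_lt_iff.1 hi
      exact ⟨x, fun _ => hx⟩
    · exact ⟨Classical.arbitrary _, fun h => absurd h hi⟩
  choose x hx using hx
  obtain ⟨p, hp, hpe⟩ := h.adjoin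
    (fun i x => (V s i).value χ (Fin.snoc (fun j => t j s i) x) < f i) x
    ((germ_lt_iff.1 hg).mono fun i hi => hx i hi)
  exact ⟨p, hp, by rw [val_snoc]; exact germ_lt_iff.2 hpe⟩

/-- A constant symbol that belongs to both languages has to be interpreted by a single point. -/
theorem Approx.exists_const {K : Bool → Set L.Symbol} (h : Approx V (K true ∩ K false) P Q)
    (c : L.Const) :
    ∃ p : Point V, Approx V (K true ∩ K false) (P ∪ {p}) Q ∧
      ∀ s, Sum.inr c ∈ K s → ∀ᶠ i in hyperfilter ℕ, p s i = (V s i).const c := by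
  obtain ⟨s₀, hs₀⟩ : ∃ s₀, ∀ s, Sum.inr c ∈ K s → Sum.inr c ∈ K s₀ := by
    by_cases hc : Sum.inr c ∈ K true
    · exact ⟨true, fun _ _ => hc⟩
    · exact ⟨false, fun s hs => by cases s <;> simp_all⟩
  obtain ⟨t, ht, htE⟩ := exists_realization (S := K true ∩ K false) (k := 1) h.countable_left
    (fun i _ => (V s₀ i).const c)
    (fun s i z => Sum.inr c ∈ K s → z 0 = (V s i).const c) (by
      intro s p hp hpx
      by_cases hc : Sum.inr c ∈ K s
      · by_cases hs : s = s₀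
        · subst hs
          exact hpx.mono fun i hi => ⟨_, hi, fun _ => rfl⟩
        · have hcS : Sum.inr c ∈ K true ∩ K false := by
            have := hs₀ s hc
            cases s <;> cases s₀ <;> simp_all
          have hp' : DefPred V (K true ∩ K false) P
              (fun s i (_ : Fin 0 → (V s i).M) => p s i fun _ => (V s i).const c) :=
            Definable.constSymbol hp hcS
          exact (h.partialIso.pred hp' s₀ s hpx).mono fun i hi => ⟨_, hi, fun _ => rfl⟩
      · refine (h.partialIso.pred hp.exists s₀ s (hpx.mono fun i hi => ⟨_, hi⟩)).mono ?_
        rintro i ⟨z, hz⟩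
        exact ⟨z, hz, fun hc' => absurd hc' hc⟩)
  have hr : Set.range t = {t 0} := by
    rw [Set.range_unique]
    rfl
  rw [hr] at ht
  exact ⟨t 0, ⟨h.countable_left.union (Set.countable_singleton _), h.countable_right, ht, h.compat,
    fun q hq => (h.isolated q hq).mono Set.subset_union_left⟩,
    fun s hs => (htE s).mono fun i hi => hi hs⟩

/-- The value `b` is matched with a value of the ultraproduct `s`, or the place of `b` relative to
`a` is decided. -/
def Decided (R : Set (Bool → Hyper)) (s : Bool) (a b : Hyper) : Prop :=
  (∃ q ∈ R, q (!s) = b) ∨ ∃ q ∈ R, q s < a ∧ b < q (!s) ∨ a < q s ∧ q (!s) < b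

theorem Approx.exists_decided (h : Approx V S P Q) (s : Bool) (a b : Hyper) :
    ∃ P' Q', P ⊆ P' ∧ Q ⊆ Q' ∧ Approx V S P' Q' ∧ Decided (defValues V S P' ∪ Q') s a b := by
  by_cases hb : ∃ q ∈ defValues V S P ∪ Q, q (!s) = b
  · exact ⟨P, Q, subset_rfl, subset_rfl, h, .inl hb⟩
  push Not at hb
  obtain ⟨c, rfl, hc⟩ := h.compat_union.exists_inCut
    ((defValues.countable h.countable_left).union h.countable_right) (.inl zero_mem_defValues)
    (.inl one_mem_defValues) (!s) b hb
  rcases le_total (c s) a with hle | hle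
  · obtain ⟨P', Q', hP, hQ, h', hr⟩ := h.separate hc s
    refine ⟨P', Q', hP, hQ, h', ?_⟩
    rcases hr with hr | ⟨r, hr, h₁, h₂⟩
    · exact .inl ⟨c, .inr hr, rfl⟩
    · exact .inr ⟨r, .inl hr, .inl ⟨h₁.trans_le hle, h₂⟩⟩
  · obtain ⟨P', Q', hP, hQ, h', hr⟩ := h.separate hc (!s)
    refine ⟨P', Q', hP, hQ, h', ?_⟩
    rcases hr with hr | ⟨r, hr, h₁, h₂⟩
    · exact .inl ⟨c, .inr hr, rfl⟩
    · rw [Bool.not_not] at h₂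
      exact .inr ⟨r, .inl hr, .inr ⟨hle.trans_lt h₂, h₁⟩⟩

/-- A union of approximations that is saturated enough to serve as a common model. -/
theorem exists_saturated {K : Bool → Set L.Symbol} (h : PartialIso V (K true ∩ K false) ∅) :
    ∃ (P : Set (Point V)) (R : Set (Bool → Hyper)), P.Countable ∧ R.Countable ∧ Compat R ∧
      defValues V (K true ∩ K false) P ⊆ R ∧
      (∀ s (n : ℕ) (χ : Formula L (n + 1)) (t : Fin n → Point V), (∀ j, t j ∈ P) →
        ∀ g ∈ (fun q => q s) '' R ∪ values V s P,
          (g < val V s (.ex χ) t → ∃ p ∈ P, g < val V s χ (Fin.snoc t p)) ∧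
          (val V s (.all χ) t < g → ∃ p ∈ P, val V s χ (Fin.snoc t p) < g)) ∧
      (∀ c : L.Const, ∃ p ∈ P, ∀ s, Sum.inr c ∈ K s →
        ∀ᶠ i in hyperfilter ℕ, p s i = (V s i).const c) ∧
      ∀ s, ∀ a ∈ values V s P, ∀ b ∈ values V (!s) P, Decided R s a b := by
  let S := K true ∩ K false
  let σ := {x : Set (Point V) × Set (Bool → Hyper) // Approx V S x.1 x.2}
  let R : σ → Set (Bool → Hyper) := fun x => defValues V S x.1.1 ∪ x.1.2
  have hR : Monotone R := fun x y hxy =>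
    Set.union_subset_union (defValues.mono hxy.1) hxy.2
  have hRc : ∀ x : σ, (R x).Countable := fun x =>
    (defValues.countable x.2.countable_left).union x.2.countable_right
  let G : σ → Bool → Set Hyper := fun x s => (fun q => q s) '' R x ∪ values V s x.1.1
  have hGc : ∀ x s, (G x s).Countable := fun x s =>
    ((hRc x).image _).union (values.countable x.2.countable_left s)
  let T₁ : σ → Set (σ → Prop) := fun x => Set.range
    fun y : Σ (s : Bool) (n : ℕ), Formula L (n + 1) × (Fin n → x.1.1) × G x s => fun z =>
      y.2.2.2.2.1 < val V y.1 (.ex y.2.2.1) (fun j => y.2.2.2.1 j) →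
        ∃ p ∈ z.1.1, y.2.2.2.2.1 < val V y.1 y.2.2.1 (Fin.snoc (fun j => (y.2.2.2.1 j).1) p)
  let T₂ : σ → Set (σ → Prop) := fun x => Set.range
    fun y : Σ (s : Bool) (n : ℕ), Formula L (n + 1) × (Fin n → x.1.1) × G x s => fun z =>
      val V y.1 (.all y.2.2.1) (fun j => y.2.2.2.1 j) < y.2.2.2.2.1 →
        ∃ p ∈ z.1.1, val V y.1 y.2.2.1 (Fin.snoc (fun j => (y.2.2.2.1 j).1) p) < y.2.2.2.2.1
  let T₃ : σ → Set (σ → Prop) := fun x => Set.range fun c : L.Const => fun z =>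
    ∃ p ∈ z.1.1, ∀ s, Sum.inr c ∈ K s → ∀ᶠ i in hyperfilter ℕ, p s i = (V s i).const c
  let T₄ : σ → Set (σ → Prop) := fun x => Set.range
    fun y : Σ s : Bool, values V s x.1.1 × values V (!s) x.1.1 => fun z =>
      Decided (R z) y.1 y.2.1 y.2.2
  have hT : ∀ x, (T₁ x ∪ T₂ x ∪ T₃ x ∪ T₄ x).Countable := by
    intro x
    have := x.2.countable_left.to_subtype
    have : ∀ s, Countable (G x s) := fun s => (hGc x s).to_subtype
    have : ∀ s, Countable (values V s x.1.1) := fun s =>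
      (values.countable x.2.countable_left s).to_subtype
    exact (((Set.countable_range _).union (Set.countable_range _)).union
      (Set.countable_range _)).union (Set.countable_range _)
  have x₀ : σ := ⟨(∅, ∅), Set.countable_empty, Set.countable_empty, h, fun q hq => hq.elim,
    fun q hq => hq.elim⟩
  have adj : ∀ (y : σ) (p : Point V) (hp : Approx V S (y.1.1 ∪ {p}) y.1.2),
      y ≤ ⟨(y.1.1 ∪ {p}, y.1.2), hp⟩ := fun y p hp => ⟨Set.subset_union_left, subset_rfl⟩
  obtain ⟨c, -, hc, hcT⟩ := exists_chain (fun x => T₁ x ∪ T₂ x ∪ T₃ x ∪ T₄ x) hT (by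
    rintro x y hxy D (((⟨⟨s, n, χ, t, g⟩, rfl⟩ | ⟨⟨s, n, χ, t, g⟩, rfl⟩) | ⟨c, rfl⟩) |
      ⟨⟨s, a, b⟩, rfl⟩)
    · by_cases hlt : g.1 < val V s (.ex χ) (fun j => t j)
      · obtain ⟨p, hp, hpg⟩ := y.2.exists_ex χ _ hlt
        exact ⟨_, adj y p hp, fun _ => ⟨p, .inr rfl, hpg⟩⟩
      · exact ⟨y, le_rfl, fun h => absurd h hlt⟩
    · by_cases hlt : val V s (.all χ) (fun j => t j) < g.1
      · obtain ⟨p, hp, hpg⟩ := y.2.exists_all χ _ hlt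
        exact ⟨_, adj y p hp, fun _ => ⟨p, .inr rfl, hpg⟩⟩
      · exact ⟨y, le_rfl, fun h => absurd h hlt⟩
    · obtain ⟨p, hp, hpc⟩ := y.2.exists_const c
      exact ⟨_, adj y p hp, ⟨p, .inr rfl, hpc⟩⟩
    · obtain ⟨P', Q', hP, hQ, h', hd⟩ := y.2.exists_decided s a b
      exact ⟨⟨(P', Q'), h'⟩, ⟨hP, hQ⟩, hd⟩) x₀
  let P : Set (Point V) := ⋃ n, (c n).1.1
  have hP : ∀ m, (c m).1.1 ⊆ P := fun m => Set.subset_iUnion (fun n => (c n).1.1) m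
  have hRm : ∀ m, R (c m) ⊆ ⋃ n, R (c n) := fun m => Set.subset_iUnion (fun n => R (c n)) m
  have tuple : ∀ {n : ℕ} (t : Fin n → Point V), (∀ j, t j ∈ P) →
      ∀ m₀, ∃ m ≥ m₀, ∀ j, t j ∈ (c m).1.1 := by
    intro n t ht m₀
    choose f hf using fun j => Set.mem_iUnion.1 (ht j)
    refine ⟨max m₀ (Finset.univ.sup f), le_max_left _ _, fun j => ?_⟩
    exact (hc ((Finset.le_sup (Finset.mem_univ j)).trans (le_max_right m₀ _))).1 (hf j)
  have hvalues : ∀ s, ∀ a ∈ values V s P, ∀ m₀, ∃ m ≥ m₀, a ∈ values V s (c m).1.1 := by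
    rintro s _ ⟨n, χ, t, ht, rfl⟩ m₀
    obtain ⟨m, hm, htm⟩ := tuple t ht m₀
    exact ⟨m, hm, n, χ, t, htm, rfl⟩
  have hvm : ∀ s {m m' : ℕ}, m ≤ m' → values V s (c m).1.1 ⊆ values V s (c m').1.1 := by
    rintro s m m' hm _ ⟨n, χ, t, ht, rfl⟩
    exact ⟨n, χ, t, fun j => (hc hm).1 (ht j), rfl⟩
  have hG : ∀ s, ∀ g ∈ (fun q => q s) '' (⋃ n, R (c n)) ∪ values V s P, ∀ m₀,
      ∃ m ≥ m₀, g ∈ G (c m) s := by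
    rintro s g (⟨q, hq, rfl⟩ | hg) m₀
    · obtain ⟨m, hm⟩ := Set.mem_iUnion.1 hq
      exact ⟨max m₀ m, le_max_left _ _, .inl ⟨q, hR (hc (le_max_right m₀ m)) hm, rfl⟩⟩
    · obtain ⟨m, hm, hgm⟩ := hvalues s g hg m₀
      exact ⟨m, hm, .inr hgm⟩
  refine ⟨P, ⋃ n, R (c n), Set.countable_iUnion fun n => (c n).2.countable_left,
    Set.countable_iUnion fun n => hRc _, ?_, ?_, ?_, ?_, ?_⟩
  · rintro q hq q' hq' s s' hle
    obtain ⟨m, hm⟩ := Set.mem_iUnion.1 hq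
    obtain ⟨m', hm'⟩ := Set.mem_iUnion.1 hq'
    exact (c (max m m')).2.compat_union q (hR (hc (le_max_left m m')) hm) q'
      (hR (hc (le_max_right m m')) hm') s s' hle
  · rintro _ ⟨F, ⟨n, χ, t, hχ, ht, rfl⟩, rfl⟩
    obtain ⟨m, -, htm⟩ := tuple t ht 0
    exact hRm m (.inl ⟨_, ⟨n, χ, t, hχ, htm, rfl⟩, rfl⟩)
  · intro s n χ t ht g hg
    obtain ⟨m₀, -, htm⟩ := tuple t ht 0
    obtain ⟨m, hm, hgm⟩ := hG s g hg m₀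
    let y : Σ (s : Bool) (n : ℕ), Formula L (n + 1) × (Fin n → (c m).1.1) × G (c m) s :=
      ⟨s, n, χ, fun j => ⟨t j, (hc hm).1 (htm j)⟩, ⟨g, hgm⟩⟩
    constructor
    · intro hlt
      obtain ⟨k, hk⟩ := hcT m _ (.inl (.inl (.inl ⟨y, rfl⟩)))
      obtain ⟨p, hp, hpg⟩ := hk hlt
      exact ⟨p, hP k hp, hpg⟩
    · intro hlt
      obtain ⟨k, hk⟩ := hcT m _ (.inl (.inl (.inr ⟨y, rfl⟩)))
      obtain ⟨p, hp, hpg⟩ := hk hlt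
      exact ⟨p, hP k hp, hpg⟩
  · intro d
    obtain ⟨k, p, hp, hpd⟩ := hcT 0 _ (.inl (.inr ⟨d, rfl⟩))
    exact ⟨p, hP k hp, hpd⟩
  · intro s a ha b hb
    obtain ⟨m₀, -, ham⟩ := hvalues s a ha 0
    obtain ⟨m, hm, hbm⟩ := hvalues (!s) b hb m₀
    obtain ⟨k, hk⟩ := hcT m _ (.inr ⟨⟨s, ⟨a, hvm s hm ham⟩, ⟨b, hbm⟩⟩, rfl⟩)
    rcases hk with ⟨q, hq, hqb⟩ | ⟨q, hq, hqab⟩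
    · exact .inl ⟨q, hRm k hq, hqb⟩
    · exact .inr ⟨q, hRm k hq, hqab⟩

/-- Matching all elements of given countable sets of nonstandard truth values. -/
theorem Compat.exists_extension {R : Set (Bool → Hyper)} (h : Compat R) (hR : R.Countable)
    (h₀ : (fun _ => 0) ∈ R) (h₁ : (fun _ => 1) ∈ R) (A : Bool → Set Hyper)
    (hA : ∀ s, (A s).Countable) :
    ∃ R', R ⊆ R' ∧ R'.Countable ∧ Compat R' ∧ (∀ s, ∀ a ∈ A s, ∃ r ∈ R', r s = a) ∧
      ∀ r ∈ R', r ∈ R ∨ ∃ s, r s ∈ A s := by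
  let σ := {R' : Set (Bool → Hyper) // R ⊆ R' ∧ R'.Countable ∧ Compat R' ∧
    ∀ r ∈ R', r ∈ R ∨ ∃ s, r s ∈ A s}
  let T : Set (σ → Prop) :=
    Set.range fun y : Σ s, A s => fun z => ∃ r ∈ z.1, r y.1 = y.2
  have : ∀ s, Countable (A s) := fun s => (hA s).to_subtype
  obtain ⟨c, -, hc, hcT⟩ := exists_chain (fun _ : σ => T) (fun _ => Set.countable_range _) (by
    rintro - ⟨R', hRR', hR', hcomp, htag⟩ - D ⟨⟨s, a⟩, rfl⟩
    by_cases ha : ∃ r ∈ R', r s = a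
    · exact ⟨_, le_rfl, ha⟩
    push Not at ha
    obtain ⟨r, hra, hr⟩ := hcomp.exists_inCut hR' (hRR' h₀) (hRR' h₁) s a ha
    refine ⟨⟨R' ∪ {r}, hRR'.trans Set.subset_union_left, hR'.union (Set.countable_singleton r),
      hcomp.union (compat_singleton r) (by rintro _ rfl; exact hr), ?_⟩, Set.subset_union_left,
      r, .inr rfl, hra⟩
    rintro r' (hr' | rfl)
    · exact htag r' hr'
    · exact .inr ⟨s, hra ▸ a.2⟩) ⟨R, subset_rfl, hR, h, fun r hr => .inl hr⟩
  refine ⟨⋃ n, (c n).1, (c 0).2.1.trans (Set.subset_iUnion (fun n => (c n).1) 0),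
    Set.countable_iUnion fun n => (c n).2.2.1, ?_, fun s a ha => ?_, fun r hr => ?_⟩
  · rintro q hq q' hq' s s' hle
    obtain ⟨m, hm⟩ := Set.mem_iUnion.1 hq
    obtain ⟨m', hm'⟩ := Set.mem_iUnion.1 hq'
    exact (c (max m m')).2.2.2.1 q (hc (le_max_left m m') hm) q' (hc (le_max_right m m') hm') s s'
      hle
  · obtain ⟨n, r, hr, hra⟩ := hcT 0 _ ⟨⟨s, a, ha⟩, rfl⟩
    exact ⟨r, Set.mem_iUnion.2 ⟨n, hr⟩, hra⟩
  · obtain ⟨m, hm⟩ := Set.mem_iUnion.1 hr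
    exact (c m).2.2.2.2 r hm

/-- The points and truth values of a common model. Each truth value of one side is matched with one
of the other side, and the quantifiers keep their values when their range is restricted to `P` and
the order of truth values to `R`. -/
theorem exists_amalgam {K : Bool → Set L.Symbol} (h : PartialIso V (K true ∩ K false) ∅) :
    ∃ (P : Set (Point V)) (R : Set (Bool → Hyper)), R.Countable ∧ Compat R ∧
      defValues V (K true ∩ K false) P ⊆ R ∧
      (∀ s, ∀ a ∈ values V s P, ∃ r ∈ R, r s = a) ∧
      (∀ s (n : ℕ) (χ : Formula L (n + 1)) (t : Fin n → Point V), (∀ j, t j ∈ P) → ∀ r ∈ R,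
        (r s < val V s (.ex χ) t → ∃ p ∈ P, r s < val V s χ (Fin.snoc t p)) ∧
        (val V s (.all χ) t < r s → ∃ p ∈ P, val V s χ (Fin.snoc t p) < r s)) ∧
      ∀ c : L.Const, ∃ p ∈ P, ∀ s, Sum.inr c ∈ K s →
        ∀ᶠ i in hyperfilter ℕ, p s i = (V s i).const c := by
  obtain ⟨P, R, hP, hR, hcomp, hdef, hwit, hconst, hdec⟩ := exists_saturated h
  obtain ⟨R', hRR', hR', hcomp', hA, htag⟩ := hcomp.exists_extension hR (hdef zero_mem_defValues)
    (hdef one_mem_defValues) (fun s => values V s P) (fun s => values.countable hP s)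
  -- The only elements of `R'` that `exists_saturated` does not account for are those that come
  -- from a value of the other side. These are separated from the values of this side by `R`.
  have key : ∀ s, ∀ r ∈ R', ∀ a ∈ values V s P,
      r s ∈ (fun q => q s) '' R ∪ values V s P ∨
        ∃ q ∈ R, (q s < a ∧ r s < q s) ∨ (a < q s ∧ q s < r s) := by
    intro s r hr a ha
    rcases htag r hr with hr₀ | ⟨s', hs'⟩
    · exact .inl (.inl ⟨r, hr₀, rfl⟩)
    by_cases hss : s' = s
    · exact .inl (.inr (hss ▸ hs'))
    obtain rfl : s' = !s := by cases s <;> cases s' <;> simp_all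
    rcases hdec s a ha _ hs' with ⟨q, hq, hqr⟩ | ⟨q, hq, hqr⟩
    · exact .inl (.inl ⟨q, hq, congrFun (hcomp'.ext (hRR' hq) hr hqr) s⟩)
    · exact .inr ⟨q, hq, hqr.imp (fun h => ⟨h.1, hcomp'.lt hr (hRR' hq) h.2⟩)
        fun h => ⟨h.1, hcomp'.lt (hRR' hq) hr h.2⟩⟩
  refine ⟨P, R', hR', hcomp', hdef.trans hRR', hA, fun s n χ t ht r hr => ⟨fun hlt => ?_,
    fun hlt => ?_⟩, hconst⟩
  · rcases key s r hr _ ⟨n, _, t, ht, rfl⟩ with hg | ⟨q, hq, ⟨h₁, h₂⟩ | ⟨h₁, h₂⟩⟩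
    · exact (hwit s n χ t ht _ hg).1 hlt
    · obtain ⟨p, hp, hpq⟩ := (hwit s n χ t ht _ (.inl ⟨q, hq, rfl⟩)).1 h₁
      exact ⟨p, hp, h₂.trans hpq⟩
    · exact absurd (h₁.trans h₂) hlt.not_gt
  · rcases key s r hr _ ⟨n, _, t, ht, rfl⟩ with hg | ⟨q, hq, ⟨h₁, h₂⟩ | ⟨h₁, h₂⟩⟩
    · exact (hwit s n χ t ht _ hg).2 hlt
    · exact absurd (h₂.trans h₁) hlt.not_gt
    · obtain ⟨p, hp, hpq⟩ := (hwit s n χ t ht _ (.inl ⟨q, hq, rfl⟩)).2 h₁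
      exact ⟨p, hp, hpq.trans h₂⟩

end Amalgam

/-! ### The common model -/

section Model

open Filter

/-- Embeddings of the two sides of an order-compatible set into the unit interval that agree on
matched truth values and preserve suprema and infima. -/
theorem Compat.exists_maps {R : Set (Bool → Hyper)} (h : Compat R) (hR : R.Countable)
    (h₀ : (fun _ => 0) ∈ R) (h₁ : (fun _ => 1) ∈ R) :
    ∃ e : Bool → Hyper → unitInterval, (∀ r ∈ R, ∀ s s', e s (r s) = e s' (r s')) ∧
      (∀ r ∈ R, ∀ r' ∈ R, ∀ s, r s < r' s → e s (r s) < e s (r' s)) ∧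
      (∀ s, e s 0 = 0) ∧ (∀ s, e s 1 = 1) ∧
      (∀ s (ι : Type w) (f : ι → Bool → Hyper), (∀ i, f i ∈ R) → ∀ r ∈ R, (∀ i, f i s ≤ r s) →
        (∀ r' ∈ R, r' s < r s → ∃ i, r' s < f i s) → e s (r s) = ⨆ i, e s (f i s)) ∧
      ∀ s (ι : Type w) (f : ι → Bool → Hyper), (∀ i, f i ∈ R) → ∀ r ∈ R, (∀ i, r s ≤ f i s) →
        (∀ r' ∈ R, r s < r' s → ∃ i, f i s < r' s) → e s (r s) = ⨅ i, e s (f i s) := by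
  let B := {a : Hyper // ∃ r ∈ R, r true = a}
  let b : ∀ r ∈ R, B := fun r hr => ⟨r true, r, hr, rfl⟩
  let _ : BoundedOrder B :=
    { bot := ⟨0, _, h₀, rfl⟩
      top := ⟨1, _, h₁, rfl⟩
      bot_le := fun x => Hyper.zero_le x.1
      le_top := fun x => Hyper.le_one x.1 }
  have : Nontrivial B := ⟨⟨⊥, ⊤, fun h => Hyper.zero_lt_one.ne (congrArg Subtype.val h)⟩⟩
  have : Countable B := (hR.image fun r => r true).to_subtype
  obtain ⟨j, hj, hj₀, hj₁, hsup, hinf⟩ := exists_continuous_embedding B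
  have hble : ∀ r (hr : r ∈ R) r' (hr' : r' ∈ R) s, b r hr ≤ b r' hr' ↔ r s ≤ r' s :=
    fun r hr r' hr' s => ⟨h r hr r' hr' true s, h r hr r' hr' s true⟩
  have hblt : ∀ r (hr : r ∈ R) r' (hr' : r' ∈ R) s, b r hr < b r' hr' ↔ r s < r' s :=
    fun r hr r' hr' s => lt_iff_lt_of_le_iff_le (hble r' hr' r hr s)
  classical
  let e : Bool → Hyper → unitInterval := fun s a =>
    if ha : ∃ r ∈ R, r s = a then j (b ha.choose ha.choose_spec.1) else 0
  have he : ∀ r (hr : r ∈ R) s, e s (r s) = j (b r hr) := by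
    intro r hr s
    have ha : ∃ r' ∈ R, r' s = r s := ⟨r, hr, rfl⟩
    have : ha.choose = r := h.ext ha.choose_spec.1 hr ha.choose_spec.2
    simp only [e, dif_pos ha]
    exact congrArg j (Subtype.ext (congrFun this true))
  refine ⟨e, fun r hr s s' => (he r hr s).trans (he r hr s').symm, fun r hr r' hr' s hlt => ?_,
    fun s => (he _ h₀ s).trans hj₀, fun s => (he _ h₁ s).trans hj₁, fun s ι f hf r hr hle hap => ?_,
    fun s ι f hf r hr hle hap => ?_⟩
  · rw [he r hr, he r' hr']
    exact hj ((hblt r hr r' hr' s).2 hlt)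
  · have hlub : IsLUB (Set.range fun i => b (f i) (hf i)) (b r hr) := by
      refine ⟨?_, fun x hx => ?_⟩
      · rintro _ ⟨i, rfl⟩
        exact (hble (f i) (hf i) r hr s).2 (hle i)
      · obtain ⟨_, r', hr', rfl⟩ := x
        refine (hble r hr r' hr' s).2 (le_of_not_gt fun hlt => ?_)
        obtain ⟨i, hi⟩ := hap r' hr' hlt
        exact hi.not_ge ((hble (f i) (hf i) r' hr' s).1 (hx ⟨i, rfl⟩))
    have := hsup _ _ hlub
    rw [← Set.range_comp] at this
    rw [he r hr, ← this.sSup_eq, sSup_range]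
    exact iSup_congr fun i => (he (f i) (hf i) s).symm
  · have hglb : IsGLB (Set.range fun i => b (f i) (hf i)) (b r hr) := by
      refine ⟨?_, fun x hx => ?_⟩
      · rintro _ ⟨i, rfl⟩
        exact (hble r hr (f i) (hf i) s).2 (hle i)
      · obtain ⟨_, r', hr', rfl⟩ := x
        refine (hble r' hr' r hr s).2 (le_of_not_gt fun hlt => ?_)
        obtain ⟨i, hi⟩ := hap r' hr' hlt
        exact hi.not_ge ((hble r' hr' (f i) (hf i) s).1 (hx ⟨i, rfl⟩))
    have := hinf _ _ hglb
    rw [← Set.range_comp] at this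
    rw [he r hr, ← this.sInf_eq, sInf_range]
    exact iInf_congr fun i => (he (f i) (hf i) s).symm

variable {L : RelLanguage.{u, v}} {V : Bool → ℕ → Valuation.{u, v, w} L}

theorem val_and {s : Bool} {n : ℕ} (χ ξ : Formula L n) (t : Fin n → Point V) :
    val V s (.and χ ξ) t = min (val V s χ t) (val V s ξ t) := by
  rcases le_total (val V s χ t) (val V s ξ t) with h | h
  · rw [min_eq_left h]
    exact Germ.coe_eq.2 ((germ_le_iff.1 h).mono fun i hi => min_eq_left hi)
  · rw [min_eq_right h]
    exact Germ.coe_eq.2 ((germ_le_iff.1 h).mono fun i hi => min_eq_right hi)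

theorem val_or {s : Bool} {n : ℕ} (χ ξ : Formula L n) (t : Fin n → Point V) :
    val V s (.or χ ξ) t = max (val V s χ t) (val V s ξ t) := by
  rcases le_total (val V s χ t) (val V s ξ t) with h | h
  · rw [max_eq_right h]
    exact Germ.coe_eq.2 ((germ_le_iff.1 h).mono fun i hi => max_eq_right hi)
  · rw [max_eq_left h]
    exact Germ.coe_eq.2 ((germ_le_iff.1 h).mono fun i hi => max_eq_left hi)

open Classical in
theorem val_imp {s : Bool} {n : ℕ} (χ ξ : Formula L n) (t : Fin n → Point V) :
    val V s (.imp χ ξ) t = if val V s χ t ≤ val V s ξ t then 1 else val V s ξ t := by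
  split_ifs with h
  · exact Germ.coe_eq.2 ((germ_le_iff.1 h).mono fun i hi => if_pos hi)
  · exact Germ.coe_eq.2 ((germ_lt_iff.1 (not_le.1 h)).mono fun i hi => if_neg hi.not_ge)

open Classical in
theorem val_delta {s : Bool} {n : ℕ} (χ : Formula L n) (t : Fin n → Point V) :
    val V s (.delta χ) t = if val V s χ t = 1 then 1 else 0 := by
  split_ifs with h
  · exact Germ.coe_eq.2 ((Germ.coe_eq.1 h).mono fun i hi => if_pos hi)
  · have h' : ¬ ∀ᶠ i in hyperfilter ℕ, (V s i).value χ (fun j => t j s i) = 1 :=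
      fun h' => h (Germ.coe_eq.2 h')
    exact Germ.coe_eq.2 ((Ultrafilter.eventually_not.2 h').mono fun i hi => if_neg hi)

theorem val_le_ex {s : Bool} {n : ℕ} (χ : Formula L (n + 1)) (t : Fin n → Point V) (p : Point V) :
    val V s χ (Fin.snoc t p) ≤ val V s (.ex χ) t := by
  rw [val_snoc]
  exact germ_le_iff.2 (.of_forall fun i =>
    le_iSup (fun x => (V s i).value χ (Fin.snoc (fun j => t j s i) x)) (p s i))

theorem val_all_le {s : Bool} {n : ℕ} (χ : Formula L (n + 1)) (t : Fin n → Point V) (p : Point V) :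
    val V s (.all χ) t ≤ val V s χ (Fin.snoc t p) := by
  rw [val_snoc]
  exact germ_le_iff.2 (.of_forall fun i =>
    iInf_le (fun x => (V s i).value χ (Fin.snoc (fun j => t j s i) x)) (p s i))

variable [∀ k, Countable (L.Rel k)] [Countable L.Const]

/-- Robinson's joint consistency theorem: two ultraproducts that agree on the closed formulas of
the common language have a common valuation, which satisfies the formulas in the language `K s` that
hold in the ultraproduct `s`, and no others. -/
theorem exists_common_valuation {K : Bool → Set L.Symbol}
    (h : PartialIso V (K true ∩ K false) ∅) :
    ∃ W : Valuation.{u, v, w} L, ∀ s (χ : ClosedFormula L), χ.symbols ⊆ K s →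
      (W.Models χ ↔ ∀ᶠ i in hyperfilter ℕ, (V s i).Models χ) := by
  classical
  obtain ⟨P, R, hR, hcomp, hdef, hval, hwit, hconst⟩ := exists_amalgam h
  have h₀ := hdef zero_mem_defValues
  have h₁ := hdef one_mem_defValues
  obtain ⟨e, hagree, hstrict, he₀, he₁, hsup, hinf⟩ := hcomp.exists_maps hR h₀ h₁
  have hne : Nonempty P := by
    obtain ⟨p, hp, -⟩ := (hwit true 0 (.imp .bot .bot) Fin.elim0 (fun j => j.elim0) _ h₀).1 (by
      refine Germ.coe_lt.2 (.of_forall fun i => ?_)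
      simp [Valuation.value])
    exact ⟨⟨p, hp⟩⟩
  choose c hcP hc using hconst
  let W : Valuation.{u, v, w} L :=
    { M := P
      nonempty := hne
      rel := fun {k} r a =>
        if Sum.inl ⟨k, r⟩ ∈ K true then e true (val V true (.rel r .var) fun i => (a i).1)
        else e false (val V false (.rel r .var) fun i => (a i).1)
      const := fun d => ⟨c d, hcP d⟩ }
  have hmem : ∀ s {n : ℕ} (χ : Formula L n) (t : Fin n → P),
      ∃ r ∈ R, r s = val V s χ fun j => (t j).1 := fun s n χ t =>
    hval s _ ⟨n, χ, _, fun j => (t j).2, rfl⟩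
  have hle : ∀ s {n : ℕ} (χ ξ : Formula L n) (t : Fin n → P),
      e s (val V s χ fun j => (t j).1) ≤ e s (val V s ξ fun j => (t j).1) ↔
        val V s χ (fun j => (t j).1) ≤ val V s ξ fun j => (t j).1 := by
    intro s n χ ξ t
    obtain ⟨r, hr, hrχ⟩ := hmem s χ t
    obtain ⟨r', hr', hrξ⟩ := hmem s ξ t
    rw [← hrχ, ← hrξ]
    refine ⟨fun hle => le_of_not_gt fun hlt => (hstrict r' hr' r hr s hlt).not_ge hle,
      fun hle => ?_⟩
    rcases hle.lt_or_eq with hlt | heq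
    · exact (hstrict r hr r' hr' s hlt).le
    · rw [heq]
  have hone : ∀ s {n : ℕ} (χ : Formula L n) (t : Fin n → P),
      e s (val V s χ fun j => (t j).1) = 1 ↔ val V s χ (fun j => (t j).1) = 1 := by
    intro s n χ t
    obtain ⟨r, hr, hrχ⟩ := hmem s χ t
    rw [← hrχ]
    refine ⟨fun heq => by_contra fun hne => ?_, fun heq => by rw [heq, he₁]⟩
    have := hstrict r hr _ h₁ s (lt_of_le_of_ne (Hyper.le_one _) hne)
    rw [heq, he₁] at this
    exact lt_irrefl _ this
  have key : ∀ s {n : ℕ} (χ : Formula L n), χ.symbols ⊆ K s → ∀ t : Fin n → P,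
      W.value χ t = e s (val V s χ fun j => (t j).1) := by
    intro s n χ
    induction χ with
    | @rel n k r ts =>
      intro hχ t
      simp only [Formula.symbols, Set.union_subset_iff, Set.singleton_subset_iff,
        Set.iUnion_subset_iff] at hχ
      -- the value of the atomic formula at the points that interpret the terms
      have hterm : val V s (.rel r .var) (fun i => (W.termValue t (ts i)).1) =
          val V s (.rel r ts) fun j => (t j).1 := by
        have hev : ∀ i, ∀ᶠ l in hyperfilter ℕ,
            (W.termValue t (ts i)).1 s l = (V s l).termValue (fun j => (t j).1 s l) (ts i) := by
          intro i
          have hi := hχ.2 i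
          cases hts : ts i with
          | var j => exact .of_forall fun l => rfl
          | const d =>
            refine hc d s ?_
            rw [hts] at hi
            exact hi rfl
        refine Germ.coe_eq.2 ((eventually_all.2 hev).mono fun l hl => ?_)
        simp only [Valuation.value, Valuation.termValue] at hl ⊢
        exact congrArg _ (funext hl)
      rw [← hterm]
      have hrel : W.value (.rel r ts) t = if Sum.inl ⟨k, r⟩ ∈ K true
          then e true (val V true (.rel r .var) fun i => (W.termValue t (ts i)).1)
          else e false (val V false (.rel r .var) fun i => (W.termValue t (ts i)).1) := rfl
      rw [hrel]
      split_ifs with hK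
      · cases s with
        | true => rfl
        | false =>
          refine hagree (fun s => val V s (.rel r .var) fun i => (W.termValue t (ts i)).1)
            (hdef ⟨_, ⟨k, .rel r .var, _, ?_, fun i => (W.termValue t (ts i)).2, rfl⟩, ?_⟩) _ _
          · simp only [Formula.symbols, Term.symbols, Set.iUnion_empty, Set.union_empty,
              Set.singleton_subset_iff]
            exact ⟨hK, hχ.1⟩
          · funext s
            simp only [val, IntFun.germ, Fin.append_elim0]
            rfl
      · cases s with
        | true => exact absurd hχ.1 hK
        | false => rfl
    | and χ ξ ih₁ ih₂ =>
      intro hχ t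
      simp only [Formula.symbols, Set.union_subset_iff] at hχ
      rw [Valuation.value, ih₁ hχ.1, ih₂ hχ.2, val_and]
      rcases le_total (val V s χ fun j => (t j).1) (val V s ξ fun j => (t j).1) with h | h
      · rw [min_eq_left h, min_eq_left ((hle s _ _ t).2 h)]
      · rw [min_eq_right h, min_eq_right ((hle s _ _ t).2 h)]
    | or χ ξ ih₁ ih₂ =>
      intro hχ t
      simp only [Formula.symbols, Set.union_subset_iff] at hχ
      rw [Valuation.value, ih₁ hχ.1, ih₂ hχ.2, val_or]
      rcases le_total (val V s χ fun j => (t j).1) (val V s ξ fun j => (t j).1) with h | h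
      · rw [max_eq_right h, max_eq_right ((hle s _ _ t).2 h)]
      · rw [max_eq_left h, max_eq_left ((hle s _ _ t).2 h)]
    | imp χ ξ ih₁ ih₂ =>
      intro hχ t
      simp only [Formula.symbols, Set.union_subset_iff] at hχ
      simp only [Valuation.value, ih₁ hχ.1, ih₂ hχ.2, val_imp, hle]
      split_ifs
      · exact (he₁ s).symm
      · rfl
    | delta χ ih =>
      intro hχ t
      simp only [Valuation.value, ih hχ, val_delta, hone]
      split_ifs
      · exact (he₁ s).symm
      · exact (he₀ s).symm
    | bot => intro _ t; exact (he₀ s).symm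
    | all χ ih =>
      intro hχ t
      have hsnoc : ∀ p : P, (fun j => ((Fin.snoc t p : Fin _ → P) j).1) =
          (Fin.snoc (fun j => (t j).1) p.1 : Fin _ → Point V) := fun p => by
        funext j
        refine Fin.lastCases ?_ (fun j => ?_) j <;> simp
      obtain ⟨r, hr, hrχ⟩ := hmem s (.all χ) t
      choose f hf hfχ using fun p : P => hmem s χ (Fin.snoc t p)
      have := hinf s P f hf r hr (fun p => by rw [hfχ, hrχ, hsnoc]; exact val_all_le χ _ _)
        (fun r' hr' hlt => by
          obtain ⟨p, hp, hpr⟩ := (hwit s _ χ _ (fun j => (t j).2) r' hr').2 (hrχ ▸ hlt)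
          exact ⟨⟨p, hp⟩, by rw [hfχ, hsnoc]; exact hpr⟩)
      rw [← hrχ, this, Valuation.value]
      exact iInf_congr fun p => by rw [ih hχ, hfχ]
    | ex χ ih =>
      intro hχ t
      have hsnoc : ∀ p : P, (fun j => ((Fin.snoc t p : Fin _ → P) j).1) =
          (Fin.snoc (fun j => (t j).1) p.1 : Fin _ → Point V) := fun p => by
        funext j
        refine Fin.lastCases ?_ (fun j => ?_) j <;> simp
      obtain ⟨r, hr, hrχ⟩ := hmem s (.ex χ) t
      choose f hf hfχ using fun p : P => hmem s χ (Fin.snoc t p)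
      have := hsup s P f hf r hr (fun p => by rw [hfχ, hrχ, hsnoc]; exact val_le_ex χ _ _)
        (fun r' hr' hlt => by
          obtain ⟨p, hp, hpr⟩ := (hwit s _ χ _ (fun j => (t j).2) r' hr').1 (hrχ ▸ hlt)
          exact ⟨⟨p, hp⟩, by rw [hfχ, hsnoc]; exact hpr⟩)
      rw [← hrχ, this, Valuation.value]
      exact iSup_congr fun p => by rw [ih hχ, hfχ]
  refine ⟨W, fun s χ hχ => ?_⟩
  have hel : ∀ {α : Type w} (a : Fin 0 → α), a = Fin.elim0 := fun a => Subsingleton.elim _ _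
  rw [Valuation.Models, key s χ hχ, hone]
  refine Germ.coe_eq.trans (eventually_congr (.of_forall fun i => ?_))
  rw [Valuation.Models]
  exact (congrArg (fun a => (V s i).value χ a = 1) (hel _)).to_iff

end Model

/-! ### Interpolation -/

section Interpolation

open Filter

variable {L : RelLanguage.{u, v}}

/-- The conjunction of the first `n` members of a sequence of formulas. -/
def Formula.conj (θ : ℕ → ClosedFormula L) : ℕ → ClosedFormula L
  | 0 => .imp .bot .bot
  | n + 1 => .and (conj θ n) (θ n)

theorem Formula.symbols_conj {S : Set L.Symbol} {θ : ℕ → ClosedFormula L}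
    (h : ∀ n, (θ n).symbols ⊆ S) : ∀ n, (conj θ n).symbols ⊆ S
  | 0 => by simp [conj, Formula.symbols]
  | n + 1 => Set.union_subset (symbols_conj h n) (h n)

theorem Valuation.models_conj (V : Valuation.{u, v, w} L) (θ : ℕ → ClosedFormula L) :
    ∀ n, V.Models (.conj θ n) ↔ ∀ m < n, V.Models (θ m)
  | 0 => by simp [Formula.conj, Valuation.Models, Valuation.value]
  | n + 1 => by
    have ih := V.models_conj θ n
    have : V.Models (.conj θ (n + 1)) ↔ V.Models (.conj θ n) ∧ V.Models (θ n) := by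
      simp only [Valuation.Models, Formula.conj, Valuation.value]
      refine ⟨fun h => ?_, fun h => by rw [h.1, h.2, min_self]⟩
      exact ⟨le_antisymm unitInterval.le_one' (h ▸ min_le_left _ _),
        le_antisymm unitInterval.le_one' (h ▸ min_le_right _ _)⟩
    rw [this, ih, Nat.forall_lt_succ_right]

/-- The formula `¬ Δ φ`, which says that `φ` does not have the value `1`. -/
def Formula.notDelta {n : ℕ} (φ : Formula L n) : Formula L n := .imp (.delta φ) .bot

theorem Formula.symbols_notDelta {n : ℕ} (φ : Formula L n) : φ.notDelta.symbols = φ.symbols := by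
  simp [Formula.notDelta, Formula.symbols]

theorem Valuation.models_notDelta (V : Valuation.{u, v, w} L) (φ : ClosedFormula L) :
    V.Models φ.notDelta ↔ ¬ V.Models φ := by
  by_cases h : V.value φ Fin.elim0 = 1 <;>
    simp [Valuation.Models, Formula.notDelta, Valuation.value, h]

theorem entails_singleton {φ ψ : ClosedFormula L} :
    Entails.{u, v, w} {φ} ψ ↔ ∀ V : Valuation.{u, v, w} L, V.Models φ → V.Models ψ := by
  simp [Entails]

/-- Compactness: if all finite conjunctions of members of `Γ` have models with the property `C`,
then `Γ` holds in an ultraproduct of valuations with this property. -/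
theorem exists_ultraproduct [∀ k, Countable (L.Rel k)] [Countable L.Const]
    (Γ : Set (ClosedFormula L)) (C : Valuation.{u, v, w} L → Prop)
    (hne : Γ.Nonempty) (h : ∀ θ : ℕ → ClosedFormula L, (∀ n, θ n ∈ Γ) → ∀ n,
      ∃ V : Valuation.{u, v, w} L, C V ∧ V.Models (.conj θ n)) :
    ∃ V : ℕ → Valuation.{u, v, w} L, (∀ i, C (V i)) ∧
      ∀ χ ∈ Γ, ∀ᶠ i in hyperfilter ℕ, (V i).Models χ := by
  obtain ⟨θ, hθ⟩ := (Set.to_countable Γ).exists_eq_range hne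
  choose V hV hVθ using h θ fun n => hθ ▸ ⟨n, rfl⟩
  refine ⟨V, hV, fun χ hχ => ?_⟩
  obtain ⟨n, rfl⟩ := hθ ▸ hχ
  filter_upwards [Nat.hyperfilter_le_atTop (eventually_gt_atTop n)] with i hi
  exact ((V i).models_conj θ i).1 (hVθ i) n hi

/-- Craig interpolation: if there is no interpolant, compactness yields an ultraproduct of models
of `φ` and an ultraproduct of countermodels of `ψ` that agree on the closed formulas of the common
language, and a common valuation of the two is a model of `φ` but not of `ψ`. -/
theorem Entails.exists_interpolant [∀ k, Countable (L.Rel k)] [Countable L.Const]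
    {φ ψ : ClosedFormula L} (h : Entails.{u, v, w} {φ} ψ) :
    ∃ θ : ClosedFormula L, θ.symbols ⊆ φ.symbols ∩ ψ.symbols ∧
      Entails.{u, v, w} {φ} θ ∧ Entails.{u, v, w} {θ} ψ := by
  by_contra hno
  push Not at hno
  simp only [entails_singleton] at h hno
  let S := φ.symbols ∩ ψ.symbols
  have htop : ∀ V : Valuation.{u, v, w} L, V.Models (.imp .bot .bot) := fun V => by
    simp [Valuation.Models, Valuation.value]
  have htopS : (Formula.imp .bot .bot : ClosedFormula L).symbols ⊆ S := by
    simp [Formula.symbols]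
  -- a nonstandard model of the consequences of `φ` in the common language in which `ψ` fails
  obtain ⟨V₀, hV₀ψ, hV₀⟩ := exists_ultraproduct
    {θ : ClosedFormula L | θ.symbols ⊆ S ∧ ∀ V : Valuation.{u, v, w} L, V.Models φ → V.Models θ}
    (fun V => ¬ V.Models ψ) ⟨_, htopS, fun V _ => htop V⟩ (fun θ hθ n => by
      have := hno (.conj θ n) (Formula.symbols_conj (fun n => (hθ n).1) n)
        fun V hV => (V.models_conj θ n).2 fun m _ => (hθ m).2 V hV
      push Not at this
      obtain ⟨V, hV, hVψ⟩ := this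
      exact ⟨V, hVψ, hV⟩)
  have hcomplete : ∀ χ : ClosedFormula L, χ.symbols ⊆ S →
      (∀ V : Valuation.{u, v, w} L, V.Models φ → ¬ V.Models χ) →
        ¬ ∀ᶠ i in hyperfilter ℕ, (V₀ i).Models χ := by
    intro χ hχ hφχ hev
    have := hV₀ χ.notDelta ⟨by rwa [Formula.symbols_notDelta],
      fun V hV => (V.models_notDelta χ).2 (hφχ V hV)⟩
    obtain ⟨i, hi, hi'⟩ := (hev.and this).exists
    exact ((V₀ i).models_notDelta χ).1 hi' hi
  -- a nonstandard model of `φ` with the same theory in the common language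
  obtain ⟨V₁, hV₁φ, hV₁⟩ := exists_ultraproduct
    {θ : ClosedFormula L | θ.symbols ⊆ S ∧ ∀ᶠ i in hyperfilter ℕ, (V₀ i).Models θ}
    (fun V => V.Models φ) ⟨_, htopS, .of_forall fun i => htop _⟩ (fun θ hθ n => by
      by_contra! hcon
      refine hcomplete _ (Formula.symbols_conj (fun n => (hθ n).1) n) hcon ?_
      simp only [Valuation.models_conj]
      exact (eventually_all_finite (Set.finite_lt_nat n)).2 fun m _ => (hθ m).2)
  let V : Bool → ℕ → Valuation.{u, v, w} L := fun s => bif s then V₁ else V₀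
  let K : Bool → Set L.Symbol := fun s => bif s then φ.symbols else ψ.symbols
  have hiso : PartialIso V (K true ∩ K false) ∅ := by
    rintro F ⟨n, χ, t, hχ, ht, rfl⟩ s s' hs
    obtain rfl : n = 0 := by
      rcases n with _ | n
      · rfl
      · exact (ht 0).elim
    have hel : ∀ {α : Type w} (a : Fin 0 → α), a = Fin.elim0 := fun a => Subsingleton.elim _ _
    have hm : ∀ s i, (V s i).value χ (Fin.append (fun j => t j s i) Fin.elim0) = 1 ↔
        (V s i).Models χ := fun s i => by
      rw [Valuation.Models]
      exact (congrArg (fun a => (V s i).value χ a = 1) (hel _)).to_iff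
    simp only [hm] at hs ⊢
    cases s <;> cases s'
    · exact hs
    · exact hV₁ χ ⟨hχ, hs⟩
    · by_contra hcon
      have := hV₁ χ.notDelta ⟨by rwa [Formula.symbols_notDelta], by
        simp only [Valuation.models_notDelta]
        exact Ultrafilter.eventually_not.2 hcon⟩
      obtain ⟨i, hi, hi'⟩ := (hs.and this).exists
      exact ((V₁ i).models_notDelta χ).1 hi' hi
    · exact hs
  obtain ⟨W, hW⟩ := exists_common_valuation hiso
  have hWφ : W.Models φ := (hW true φ subset_rfl).2 (.of_forall hV₁φ)
  obtain ⟨i, hi⟩ := ((hW false ψ subset_rfl).1 (h W hWφ)).exists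
  exact hV₀ψ i hi

end Interpolation

end GodelDelta

theorem theorem3p2 (L : GodelDelta.RelLanguage.{u, v})
    [∀ k, Countable (L.Rel k)] [Countable L.Const]
    (φ ψ : GodelDelta.ClosedFormula L) (h : GodelDelta.Entails.{u, v, w} {φ} ψ) :
    ∃ θ : GodelDelta.ClosedFormula L,
      θ.symbols ⊆ φ.symbols ∩ ψ.symbols ∧
        GodelDelta.Entails.{u, v, w} {φ} θ ∧ GodelDelta.Entails.{u, v, w} {θ} ψ :=
  h.exists_interpolant
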